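/- Let $N\ge 0$, let $(\eta^{ij})$ be a constant real symmetric $N\times N$ matrix with $\det(\eta^{ij})\neq 0$, let $K_1\in\mathbb R$, let $U\subseteq\mathbb R^N$ be open with coordinates $u=(u^1,\dots,u^N)$, and let $H^1,\dots,H^N:U\to\mathbb R$ be smooth. Summation over repeated indices is understood. Consider the nonlocal bracket $$\{I,J\}[u]=\int_{\mathbb R}\frac{\delta I}{\delta u^i(x)}\Big(g_1^{ij}(u)\frac{d}{dx}+b^{ij}_{1,k}(u)\,u^k_x+K_1u^i_x\Big(\frac{d}{dx}\Big)^{-1}u^j_x\Big)\frac{\delta J}{\delta u^j(x)}\,dx,$$ $$g_1^{ij}=\eta^{is}\frac{\partial H^j}{\partial u^s}+\eta^{js}\frac{\partial H^i}{\partial u^s}-K_1u^iu^j,\qquad b_{1,k}^{ij}=\eta^{is}\frac{\partial^2H^j}{\partial u^s\partial u^k}-K_1\delta^i_ku^j,$$ where no nondegeneracy of $(g_1^{ij})$ is assumed. Here the fields are the smooth maps $u:\mathbb R\to U$ such that $u_x$ has compact support; $(d/dx)^{-1}f(x)=\frac12\big(\int_{-\infty}^xf\,dy-\int_x^\infty f\,dy\big)$;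 the functionals are the smooth ones, that is, those real functions $I$ of the field that have at every field a variational derivative $\delta I/\delta u\in C_c^\infty(\mathbb R,\mathbb R^N)$ (with $\frac{d}{dt}I[u+th]\big|_{t=0}=\int\frac{\delta I}{\delta u^i}h^i\,dx$ for all $h\in C_c^\infty(\mathbb R,\mathbb R^N)$), and such that along every finite-dimensional family of fields $u(s,\cdot)$ that is jointly smooth in $(s,x)$, and locally in $s$ is independent of $s$ for large $|x|$, the value $I[u(s,\cdot)]$ is smooth in $s$ and $\delta I/\delta u(x)$ is jointly smooth in $(s,x)$ with support in $x$ locally uniformly bounded in $s$. The bracket is called a Poisson bracket if it maps pairs of smooth functionals to smooth functionals, is skew-symmetric, and satisfies the Jacobi identity $\{\{I,J\},L\}+\{\{J,L\},I\}+\{\{L,I\},J\}=0$. Then this bracket is a Poisson bracket if and only if the following two systems of equations hold on $U$ for all values of the free indices: $$\frac{\partial^2H^i}{\partial u^k\partial u^s}\,\eta^{sp}\,\frac{\partial^2H^j}{\partial u^p\partial u^l}=\frac{\partial^2H^j}{\partial u^k\partial u^s}\,\eta^{sp}\,\frac{\partial^2H^i}{\partial u^p\partial u^l},$$ $$\Big(\eta^{ir}\frac{\partial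 H^s}{\partial u^r}+\eta^{sr}\frac{\partial H^i}{\partial u^r}-K_1u^iu^s\Big)\eta^{jp}\frac{\partial^2H^k}{\partial u^p\partial u^s}=\Big(\eta^{jr}\frac{\partial H^s}{\partial u^r}+\eta^{sr}\frac{\partial H^j}{\partial u^r}-K_1u^ju^s\Big)\eta^{ip}\frac{\partial^2H^k}{\partial u^p\partial u^s}.$$ -/

import Mathlib

open scoped ContDiff Topology

namespace Hydro

noncomputable section

/-- The partial derivative `∂f/∂uᵏ`. -/
def pd {N : ℕ} (k : Fin N) (f : (Fin N → ℝ) → ℝ) (u : Fin N → ℝ) : ℝ :=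
  fderiv ℝ f u (Pi.single k 1)

/-- The phase space: smooth fields `u : ℝ → U ⊆ ℝᴺ` whose derivative `u_x` has compact support
(so `u` is constant near `-∞` and near `+∞`, with possibly different constants). -/
def IsField {N : ℕ} (U : Set (Fin N → ℝ)) (u : ℝ → Fin N → ℝ) : Prop :=
  ContDiff ℝ ∞ u ∧ (∀ x, u x ∈ U) ∧ HasCompactSupport (deriv u)

/-- Smooth compactly supported vector functions of `x`; they serve both as variations of the
fields and as variational derivatives of functionals. -/
def IsTest {N : ℕ} (h : ℝ → Fin N → ℝ) : Prop :=
  ContDiff ℝ ∞ h ∧ HasCompactSupport h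

/-- `φ` is the variational derivative `δF/δu(x)` of the functional `F` at the field `u`:
`d/dt F[u + t h] = ∫ φᵢ(x) hⁱ(x) dx` at `t = 0` for every variation `h`. -/
def HasVarDeriv {N : ℕ} (F : (ℝ → Fin N → ℝ) → ℝ) (u φ : ℝ → Fin N → ℝ) : Prop :=
  IsTest φ ∧ ∀ h : ℝ → Fin N → ℝ, IsTest h →
    HasDerivAt (fun t : ℝ => F (u + t • h)) (∫ x, ∑ i, φ x i * h x i) 0

open Classical in
/-- The variational derivative `δF/δu(x)` (it is unique when it exists). -/
def varDeriv {N : ℕ} (F : (ℝ → Fin N → ℝ) → ℝ) (u : ℝ → Fin N → ℝ) : ℝ → Fin N → ℝ :=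
  if h : ∃ φ, HasVarDeriv F u φ then h.choose else 0

/-- A smooth family of fields with parameter `s` in the open set `V ⊆ ℝᵐ`: jointly smooth in
`(s, x)` and, locally in `s`, varying only over a bounded interval of `x`. -/
structure IsSmoothFamily {N m : ℕ} (U : Set (Fin N → ℝ)) (V : Set (Fin m → ℝ))
    (γ : (Fin m → ℝ) → ℝ → Fin N → ℝ) : Prop where
  isOpen : IsOpen V
  isField : ∀ s ∈ V, IsField U (γ s)
  smooth : ContDiffOn ℝ ∞ (fun p : (Fin m → ℝ) × ℝ => γ p.1 p.2) (V ×ˢ Set.univ)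
  locally_fixed : ∀ s₀ ∈ V, ∃ R : ℝ, ∀ᶠ s in 𝓝 s₀, ∀ x : ℝ, R < |x| → γ s x = γ s₀ x

/-- A smooth functional on the space of fields with values in `U`: it has a variational derivative
at every field, and along every smooth finite-dimensional family of fields both the functional and
its variational derivative depend smoothly on the parameters (the support of the variational
derivative being locally uniformly bounded).  Only the values of `F` on fields matter. -/
structure IsFunctional {N : ℕ} (U : Set (Fin N → ℝ)) (F : (ℝ → Fin N → ℝ) → ℝ) : Prop where
  exists_varDeriv : ∀ u, IsField U u → ∃ φ, HasVarDeriv F u φ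
  smooth : ∀ (m : ℕ) (V : Set (Fin m → ℝ)) (γ : (Fin m → ℝ) → ℝ → Fin N → ℝ),
    IsSmoothFamily U V γ → ContDiffOn ℝ ∞ (fun s => F (γ s)) V
  smooth_varDeriv : ∀ (m : ℕ) (V : Set (Fin m → ℝ)) (γ : (Fin m → ℝ) → ℝ → Fin N → ℝ),
    IsSmoothFamily U V γ →
      ContDiffOn ℝ ∞ (fun p : (Fin m → ℝ) × ℝ => varDeriv F (γ p.1) p.2) (V ×ˢ Set.univ)
  support_varDeriv : ∀ (m : ℕ) (V : Set (Fin m → ℝ)) (γ : (Fin m → ℝ) → ℝ → Fin N → ℝ),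
    IsSmoothFamily U V γ → ∀ s₀ ∈ V, ∃ R : ℝ, ∀ᶠ s in 𝓝 s₀, ∀ x : ℝ, R < |x| →
      varDeriv F (γ s) x = 0

/-- The skew-symmetric inverse `(d/dx)⁻¹` of `d/dx`, that is, convolution with `sgn(x) / 2`. -/
def invD (f : ℝ → ℝ) (x : ℝ) : ℝ :=
  ((∫ y in Set.Iic x, f y) - ∫ y in Set.Ioi x, f y) / 2

/-- The operator `gⁱʲ(u) d/dx + bⁱʲₖ(u) uᵏₓ + K uⁱₓ (d/dx)⁻¹ uʲₓ` at the field `u`, applied to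
the covector `ξ`.  Here `g v i j` is `gⁱʲ(v)` and `b v i j k` is `bⁱʲₖ(v)`. -/
def hydroOp {N : ℕ} (g : (Fin N → ℝ) → Fin N → Fin N → ℝ)
    (b : (Fin N → ℝ) → Fin N → Fin N → Fin N → ℝ) (K : ℝ)
    (u ξ : ℝ → Fin N → ℝ) (x : ℝ) (i : Fin N) : ℝ :=
  (∑ j, g (u x) i j * deriv (fun y => ξ y j) x)
    + (∑ j, ∑ k, b (u x) i j k * deriv (fun y => u y k) x * ξ x j)
    + K * deriv (fun y => u y i) x
        * invD (fun y => ∑ j, deriv (fun z => u z j) y * ξ y j) x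

/-- The bracket `{I, J}[u] = ∫ δI/δuⁱ(x) (g d/dx + b uₓ + K uₓ (d/dx)⁻¹ uₓ)ⁱʲ δJ/δuʲ(x) dx`. -/
def bracket {N : ℕ} (g : (Fin N → ℝ) → Fin N → Fin N → ℝ)
    (b : (Fin N → ℝ) → Fin N → Fin N → Fin N → ℝ) (K : ℝ)
    (I J : (ℝ → Fin N → ℝ) → ℝ) (u : ℝ → Fin N → ℝ) : ℝ :=
  ∫ x, ∑ i, varDeriv I u x i * hydroOp g b K u (varDeriv J u) x i

/-- The bracket given by `g`, `b`, `K` over `U` is a Poisson bracket: it is an operation on smooth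
functionals, it is skew-symmetric, and it satisfies the Jacobi identity.  (Bilinearity and the
Leibniz rule hold for every bracket of this form.) -/
structure IsPoissonBracket {N : ℕ} (U : Set (Fin N → ℝ))
    (g : (Fin N → ℝ) → Fin N → Fin N → ℝ)
    (b : (Fin N → ℝ) → Fin N → Fin N → Fin N → ℝ) (K : ℝ) : Prop where
  closed : ∀ I J, IsFunctional U I → IsFunctional U J → IsFunctional U (bracket g b K I J)
  skew : ∀ I J, IsFunctional U I → IsFunctional U J →
    ∀ u, IsField U u → bracket g b K I J u = - bracket g b K J I u
  jacobi : ∀ I J L, IsFunctional U I → IsFunctional U J → IsFunctional U L →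
    ∀ u, IsField U u →
      bracket g b K (bracket g b K I J) L u
        + bracket g b K (bracket g b K J L) I u
        + bracket g b K (bracket g b K L I) J u = 0

/-- `g₁ⁱʲ = ηⁱˢ ∂Hʲ/∂uˢ + ηʲˢ ∂Hⁱ/∂uˢ - K₁ uⁱ uʲ`. -/
def canonicalMetric {N : ℕ} (η : Matrix (Fin N) (Fin N) ℝ) (K₁ : ℝ)
    (H : Fin N → (Fin N → ℝ) → ℝ) (u : Fin N → ℝ) (i j : Fin N) : ℝ :=
  (∑ s, η i s * pd s (H j) u) + (∑ s, η j s * pd s (H i) u) - K₁ * u i * u j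

/-- `b₁ⁱʲₖ = ηⁱˢ ∂²Hʲ/∂uˢ∂uᵏ - K₁ δⁱₖ uʲ`. -/
def canonicalConnection {N : ℕ} (η : Matrix (Fin N) (Fin N) ℝ) (K₁ : ℝ)
    (H : Fin N → (Fin N → ℝ) → ℝ) (u : Fin N → ℝ) (i j k : Fin N) : ℝ :=
  (∑ s, η i s * pd s (pd k (H j)) u) - K₁ * (if i = k then 1 else 0) * u j

end

end Hydro

/-! Write `P` for the Hamiltonian operator and `E(ξ) = ξⱼ ∂²Hʲ`. Since `(d/dx)⁻¹(u_x·ζ) = u·ζ -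
(d/dx)⁻¹(u·ζ_x)`, the term `-K₁ δⁱₖ uʲ` of the connection absorbs the local part of the tail, so
that `Pζ = g₁ζ_x + ηE(ζ)u_x - K₁ p(ζ) u_x` with `p(ζ) = (d/dx)⁻¹(u·ζ_x)`. Up to a total derivative,
`ξ·Pζ` is a density without derivatives of `u` (`formDensity`); the bracket is therefore skew for
every choice of `H`, because `(d/dx)⁻¹` is skew. Differentiating under the integral gives its
variational derivative (`hasVarDeriv_bracket`), so smooth functionals are preserved as well. Only
the Jacobi identity imposes conditions.

In the Jacobi sum the second variations cancel because they are symmetric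
(`IsFunctional.integral_secondVar_comm`). What remains is the integral of `jacobiDensity`, an
expression in the three covectors alone. Since linear functionals realise every triple of test
covectors, the bracket is Poisson exactly when this integral vanishes identically.

The symmetry of `η`, `g₁` and the Hessians cancels every potential pointwise (`jacobiDensity_eq`).
Two kinds of terms survive: the skew part of `ηE(ξ)g₁` paired with two derivatives of covectors, and
`η[E(ξ)ηE(ζ) - E(ζ)ηE(ξ)]` paired with `u_x` and one derivative. The two systems say that both
vanish, which gives sufficiency. For necessity, bump functions isolate one term of each kind: a
constant field for the first (`metricDefect_eq_zero_of_jacobi`), a small excursion in a chosen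
direction for the second (`hessDefect_eq_zero_of_jacobi`). Invertibility of `η` removes the outer
factor `η`; `g₁` is never inverted. -/

namespace Hydro

noncomputable section

open MeasureTheory Set Filter Matrix

set_option linter.unusedSectionVars false

/-! ### Parametric integrals and mixed derivatives -/

section Calculus

variable {P : Type*} [NormedAddCommGroup P] [NormedSpace ℝ P]
variable {Q : Type*} [NormedAddCommGroup Q] [NormedSpace ℝ Q]
variable {E : Type*} [NormedAddCommGroup E] [NormedSpace ℝ E]
variable {F : Type*} [NormedAddCommGroup F] [NormedSpace ℝ F]

/-- A smooth family of compactly supported functions of `x` with parameter in `V`: jointly smooth,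
with locally uniformly bounded support. -/
structure IsTestFamily (V : Set P) (f : P → ℝ → E) : Prop where
  smooth : ContDiffOn ℝ ∞ (fun p : P × ℝ => f p.1 p.2) (V ×ˢ univ)
  support : ∀ s₀ ∈ V, ∃ R : ℝ, ∀ᶠ s in 𝓝 s₀, ∀ x : ℝ, R < |x| → f s x = 0

theorem hasCompactSupport_of_bound {f : ℝ → E} {R : ℝ} (h : ∀ x, R < |x| → f x = 0) :
    HasCompactSupport f := by
  refine HasCompactSupport.intro (isCompact_Icc (a := -R) (b := R)) fun x hx => h x ?_
  by_contra! hc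
  exact hx (abs_le.1 hc)

theorem exists_bound_of_hasCompactSupport {f : ℝ → E} (h : HasCompactSupport f) :
    ∃ R : ℝ, ∀ x, R < |x| → f x = 0 := by
  obtain ⟨R, hR⟩ := h.isCompact.isBounded.subset_closedBall 0
  refine ⟨R, fun x hx => image_eq_zero_of_notMem_tsupport fun hxs => ?_⟩
  have := hR hxs
  rw [mem_closedBall_zero_iff, Real.norm_eq_abs] at this
  linarith

theorem prod_univ_mem_nhds {V : Set P} (hV : IsOpen V) {p : P × ℝ} (hp : p.1 ∈ V) :
    V ×ˢ (univ : Set ℝ) ∈ 𝓝 p :=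
  (hV.prod isOpen_univ).mem_nhds ⟨hp, mem_univ _⟩

theorem contDiff_slice {V : Set P} {f : P → ℝ → E}
    (hf : ContDiffOn ℝ ∞ (fun p : P × ℝ => f p.1 p.2) (V ×ˢ univ)) {s : P} (hs : s ∈ V) :
    ContDiff ℝ ∞ (f s) := by
  have : ContDiffOn ℝ ∞ (fun x : ℝ => f s x) univ :=
    hf.comp (f := fun x : ℝ => ((s, x) : P × ℝ)) (by fun_prop) fun x _ => ⟨hs, mem_univ _⟩
  exact contDiffOn_univ.1 this

theorem contDiffOn_slice {V : Set P} {f : P → ℝ → E}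
    (hf : ContDiffOn ℝ ∞ (fun p : P × ℝ => f p.1 p.2) (V ×ˢ univ)) (x : ℝ) :
    ContDiffOn ℝ ∞ (fun s => f s x) V :=
  hf.comp (f := fun s : P => (s, x)) (by fun_prop) fun s hs => ⟨hs, mem_univ _⟩

/-- The derivative in `x` of a jointly smooth family is jointly smooth. -/
theorem contDiffOn_deriv_snd {V : Set P} (hV : IsOpen V) {f : P → ℝ → E}
    (hf : ContDiffOn ℝ ∞ (fun p : P × ℝ => f p.1 p.2) (V ×ˢ univ)) :
    ContDiffOn ℝ ∞ (fun p : P × ℝ => deriv (f p.1) p.2) (V ×ˢ univ) := by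
  have h1 : ContDiffOn ℝ ∞ (fun p : P × ℝ => fderiv ℝ (fun p : P × ℝ => f p.1 p.2) p (0, 1))
      (V ×ˢ univ) :=
    (hf.fderiv_of_isOpen (hV.prod isOpen_univ) (m := ∞) (by simp)).clm_apply contDiffOn_const
  refine h1.congr fun p hp => ?_
  have h2 : HasFDerivAt (fun p : P × ℝ => f p.1 p.2)
      (fderiv ℝ (fun p : P × ℝ => f p.1 p.2) p) p :=
    ((hf.contDiffAt (prod_univ_mem_nhds hV hp.1)).differentiableAt (by simp)).hasFDerivAt
  have h3 : HasDerivAt (fun x : ℝ => ((p.1, x) : P × ℝ)) (0, 1) p.2 :=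
    (hasDerivAt_const _ _).prodMk (hasDerivAt_id _)
  exact (h2.comp_hasDerivAt p.2 (by simpa using h3)).deriv

/-- The derivative in the last real parameter of a jointly smooth family is jointly smooth. -/
theorem contDiffOn_deriv_param {V : Set (P × ℝ)} (hV : IsOpen V) {f : P × ℝ → ℝ → E}
    (hf : ContDiffOn ℝ ∞ (fun p : (P × ℝ) × ℝ => f p.1 p.2) (V ×ˢ univ)) :
    ContDiffOn ℝ ∞ (fun p : P × ℝ => deriv (fun t => f (p.1, t) p.2) 0)
      ({s | (s, (0 : ℝ)) ∈ V} ×ˢ univ) := by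
  have h1 : ContDiffOn ℝ ∞
      (fun p : (P × ℝ) × ℝ => fderiv ℝ (fun p : (P × ℝ) × ℝ => f p.1 p.2) p ((0, 1), 0))
      (V ×ˢ univ) :=
    (hf.fderiv_of_isOpen (hV.prod isOpen_univ) (m := ∞) (by simp)).clm_apply contDiffOn_const
  have h4 := h1.comp (f := fun p : P × ℝ => ((p.1, (0 : ℝ)), p.2))
    (s := {s | (s, (0 : ℝ)) ∈ V} ×ˢ univ) (by fun_prop) fun p hp => ⟨hp.1, mem_univ _⟩
  refine h4.congr fun p hp => ?_
  have h2 : HasFDerivAt (fun p : (P × ℝ) × ℝ => f p.1 p.2)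
      (fderiv ℝ (fun p : (P × ℝ) × ℝ => f p.1 p.2) ((p.1, (0 : ℝ)), p.2)) ((p.1, (0 : ℝ)), p.2) :=
    ((hf.contDiffAt (prod_univ_mem_nhds (p := ((p.1, (0 : ℝ)), p.2)) hV hp.1)).differentiableAt
      (by simp)).hasFDerivAt
  have h3 : HasDerivAt (fun t : ℝ => (((p.1, t), p.2) : (P × ℝ) × ℝ)) ((0, 1), 0) 0 :=
    ((hasDerivAt_const _ _).prodMk (hasDerivAt_id _)).prodMk (hasDerivAt_const _ _)
  exact (h2.comp_hasDerivAt (0 : ℝ) h3).deriv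

/-- Mixed second derivatives of a `C²` function of two real variables agree. -/
theorem deriv_deriv_comm {f : ℝ → ℝ → E} {a b : ℝ}
    (hf : ContDiffAt ℝ 2 (fun p : ℝ × ℝ => f p.1 p.2) (a, b)) :
    deriv (fun s => deriv (fun t => f s t) b) a = deriv (fun t => deriv (fun s => f s t) a) b := by
  set g : ℝ × ℝ → E := fun p => f p.1 p.2 with hg
  have hev : ∀ᶠ p in 𝓝 (a, b), HasFDerivAt g (fderiv ℝ g p) p := by
    filter_upwards [hf.eventually (by simp)] with p hp
    exact (hp.differentiableAt (by simp)).hasFDerivAt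
  have hd : HasFDerivAt (fderiv ℝ g) (fderiv ℝ (fderiv ℝ g) (a, b)) (a, b) :=
    ((hf.fderiv_right (m := 1) (by norm_num)).differentiableAt (by simp)).hasFDerivAt
  have hsymm : IsSymmSndFDerivAt ℝ g (a, b) := hf.isSymmSndFDerivAt (by simp)
  have c1 : ∀ s t : ℝ, HasDerivAt (fun s : ℝ => (s, t)) ((1, 0) : ℝ × ℝ) s := fun s t =>
    (hasDerivAt_id _).prodMk (hasDerivAt_const _ _)
  have c2 : ∀ s t : ℝ, HasDerivAt (fun t : ℝ => (s, t)) ((0, 1) : ℝ × ℝ) t := fun s t =>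
    (hasDerivAt_const _ _).prodMk (hasDerivAt_id _)
  have e1 : (fun s => deriv (fun t => f s t) b) =ᶠ[𝓝 a] fun s => fderiv ℝ g (s, b) (0, 1) := by
    have : Tendsto (fun s : ℝ => (s, b)) (𝓝 a) (𝓝 (a, b)) := (c1 a b).continuousAt
    filter_upwards [this.eventually hev] with s hs
    exact (hs.comp_hasDerivAt b (c2 s b)).deriv
  have e2 : (fun t => deriv (fun s => f s t) a) =ᶠ[𝓝 b] fun t => fderiv ℝ g (a, t) (1, 0) := by
    have : Tendsto (fun t : ℝ => (a, t)) (𝓝 b) (𝓝 (a, b)) := (c2 a b).continuousAt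
    filter_upwards [this.eventually hev] with t ht
    exact (ht.comp_hasDerivAt a (c1 a t)).deriv
  rw [e1.deriv_eq, e2.deriv_eq]
  have d1 : HasDerivAt (fun s => fderiv ℝ g (s, b) (0, 1))
      (fderiv ℝ (fderiv ℝ g) (a, b) (1, 0) (0, 1)) a :=
    ((ContinuousLinearMap.apply ℝ E ((0 : ℝ), (1 : ℝ))).hasFDerivAt.comp_hasDerivAt a
      (hd.comp_hasDerivAt a (c1 a b)))
  have d2 : HasDerivAt (fun t => fderiv ℝ g (a, t) (1, 0))
      (fderiv ℝ (fderiv ℝ g) (a, b) (0, 1) (1, 0)) b :=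
    ((ContinuousLinearMap.apply ℝ E ((1 : ℝ), (0 : ℝ))).hasFDerivAt.comp_hasDerivAt b
      (hd.comp_hasDerivAt b (c2 a b)))
  rw [d1.deriv, d2.deriv]
  exact hsymm _ _

namespace IsTestFamily

variable {V : Set P} {f : P → ℝ → E}

theorem contDiff (hf : IsTestFamily V f) {s : P} (hs : s ∈ V) : ContDiff ℝ ∞ (f s) :=
  contDiff_slice hf.smooth hs

theorem hasCompactSupport (hf : IsTestFamily V f) {s : P} (hs : s ∈ V) :
    HasCompactSupport (f s) := by
  obtain ⟨R, hR⟩ := hf.support s hs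
  exact hasCompactSupport_of_bound hR.self_of_nhds

theorem derivX (hV : IsOpen V) (hf : IsTestFamily V f) :
    IsTestFamily V fun s x => deriv (f s) x := by
  refine ⟨contDiffOn_deriv_snd hV hf.smooth, fun s₀ hs₀ => ?_⟩
  obtain ⟨R, hR⟩ := hf.support s₀ hs₀
  refine ⟨R, hR.mono fun s hs x hx => ?_⟩
  have : f s =ᶠ[𝓝 x] fun _ => 0 := by
    filter_upwards [(isOpen_lt continuous_const continuous_abs).mem_nhds hx] with y hy
    exact hs y hy
  rw [this.deriv_eq]
  simp

theorem continuous (hf : IsTestFamily V f) {s : P} (hs : s ∈ V) : Continuous (f s) :=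
  (hf.contDiff hs).continuous

theorem prodMk {g : P → ℝ → F} (hf : IsTestFamily V f) (hg : IsTestFamily V g) :
    IsTestFamily V fun s x => (f s x, g s x) := by
  refine ⟨hf.smooth.prodMk hg.smooth, fun s₀ hs₀ => ?_⟩
  obtain ⟨R, hR⟩ := hf.support s₀ hs₀
  obtain ⟨R', hR'⟩ := hg.support s₀ hs₀
  refine ⟨max R R', ?_⟩
  filter_upwards [hR, hR'] with s h h' x hx
  rw [h x (lt_of_le_of_lt (le_max_left _ _) hx), h' x (lt_of_le_of_lt (le_max_right _ _) hx)]
  rfl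

/-- A jointly smooth family that vanishes wherever a test family does is a test family. -/
theorem of_eq_zero {g : P → ℝ → F} (hV : IsOpen V) (hf : IsTestFamily V f)
    (hg : ContDiffOn ℝ ∞ (fun p : P × ℝ => g p.1 p.2) (V ×ˢ univ))
    (h : ∀ s ∈ V, ∀ x, f s x = 0 → g s x = 0) : IsTestFamily V g := by
  refine ⟨hg, fun s₀ hs₀ => ?_⟩
  obtain ⟨R, hR⟩ := hf.support s₀ hs₀
  refine ⟨R, ?_⟩
  filter_upwards [hR, hV.mem_nhds hs₀] with s hs hsV x hx using h s hsV x (hs x hx)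

theorem comp {W : Set Q} (hf : IsTestFamily V f) {L : Q → P} (hL : ContDiff ℝ ∞ L)
    (hLW : MapsTo L W V) : IsTestFamily W fun q => f (L q) := by
  refine ⟨hf.smooth.comp (f := fun p : Q × ℝ => (L p.1, p.2)) (by fun_prop)
    fun p hp => ⟨hLW hp.1, mem_univ _⟩, fun s₀ hs₀ => ?_⟩
  obtain ⟨R, hR⟩ := hf.support _ (hLW hs₀)
  exact ⟨R, hL.continuous.continuousAt.eventually hR⟩

theorem const {h : ℝ → E} (hh : ContDiff ℝ ∞ h) (hc : HasCompactSupport h) (V : Set P) :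
    IsTestFamily V fun _ => h := by
  obtain ⟨R, hR⟩ := exists_bound_of_hasCompactSupport hc
  refine ⟨(hh.comp contDiff_snd).contDiffOn, fun _ _ => ⟨R, ?_⟩⟩
  exact Eventually.of_forall fun _ => hR

/-- Locally in the parameter, a test family is supported in one compact set. -/
theorem exists_isCompact (hV : IsOpen V) (hf : IsTestFamily V f) {s₀ : P} (hs₀ : s₀ ∈ V) :
    ∃ W ⊆ V, IsOpen W ∧ s₀ ∈ W ∧ ∃ k : Set ℝ, IsCompact k ∧
      ∀ s x, s ∈ W → x ∉ k → f s x = 0 := by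
  obtain ⟨R, hR⟩ := hf.support s₀ hs₀
  obtain ⟨W, hW, hWo, hsW⟩ := eventually_nhds_iff.1 hR
  refine ⟨W ∩ V, inter_subset_right, hWo.inter hV, ⟨hsW, hs₀⟩, Icc (-R) R, isCompact_Icc, ?_⟩
  intro s x hs hx
  refine hW s hs.1 x ?_
  by_contra! hc
  exact hx (abs_le.1 hc)

/-- Convolution of a test family with a locally integrable kernel is jointly smooth. -/
theorem contDiffOn_kernel {f : P → ℝ → ℝ} (hV : IsOpen V) (hf : IsTestFamily V f) {k : ℝ → ℝ}
    (hk : LocallyIntegrable k) :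
    ContDiffOn ℝ ∞ (fun p : P × ℝ => ∫ y, k (p.2 - y) * f p.1 y) (V ×ˢ univ) := by
  rintro ⟨s₀, x₀⟩ ⟨hs₀, -⟩
  -- Smoothness is local in the parameter, so `V` may shrink until one compact set carries all
  -- supports.
  obtain ⟨W, hWV, hWo, hsW, K, hK, hfK⟩ := hf.exists_isCompact hV hs₀
  have h := contDiffOn_convolution_right_with_param (μ := volume) (n := ⊤)
    (ContinuousLinearMap.mul ℝ ℝ) hWo hK hfK hk
    (hf.smooth.mono (prod_mono hWV subset_rfl))
  refine ContDiffAt.contDiffWithinAt ?_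
  have h2 := h.contDiffAt (prod_univ_mem_nhds (p := (s₀, x₀)) hWo hsW)
  refine h2.congr_of_eventuallyEq (Eventually.of_forall fun p => ?_)
  simp [convolution_eq_swap]

/-- This is the joint derivative of a parametric convolution, evaluated in the parameter direction
`(1, 0)`. All regularity is taken from `f`, so the kernel may jump, as `signKernel` does. -/
theorem hasDerivAt_kernel {V : Set ℝ} {f : ℝ → ℝ → ℝ} (hV : IsOpen V) (hf : IsTestFamily V f)
    {k : ℝ → ℝ} (hk : LocallyIntegrable k) {t : ℝ} (ht : t ∈ V) (x : ℝ) :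
    HasDerivAt (fun t => ∫ y, k (x - y) * f t y)
      (∫ y, k (x - y) * deriv (fun t => f t y) t) t := by
  obtain ⟨W, hWV, hWo, hsW, K, hK, hfK⟩ := hf.exists_isCompact hV ht
  have hsm := hf.smooth.mono (prod_mono hWV (subset_refl (univ : Set ℝ)))
  have h := hasFDerivAt_convolution_right_with_param (μ := volume)
    (ContinuousLinearMap.mul ℝ ℝ) hWo hK hfK hk (hsm.of_le (by simp)) (t, x) hsW
  have hc : HasDerivAt (fun t : ℝ => (t, x)) ((1, 0) : ℝ × ℝ) t :=
    (hasDerivAt_id _).prodMk (hasDerivAt_const _ _)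
  have h2 := h.comp_hasDerivAt t hc
  have hfd : ContDiffOn ℝ ∞ (fderiv ℝ (fun p : ℝ × ℝ => f p.1 p.2)) (W ×ˢ univ) :=
    hsm.fderiv_of_isOpen (hWo.prod isOpen_univ) (by simp)
  have hcont : Continuous fun y => fderiv ℝ (fun p : ℝ × ℝ => f p.1 p.2) (t, y) :=
    hfd.continuousOn.comp_continuous (by fun_prop) fun y => ⟨hsW, mem_univ _⟩
  have hzero : ∀ y, y ∉ K → fderiv ℝ (fun p : ℝ × ℝ => f p.1 p.2) (t, y) = 0 := by
    intro y hy
    have : (fun p : ℝ × ℝ => f p.1 p.2) =ᶠ[𝓝 (t, y)] fun _ => 0 := by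
      filter_upwards [(hWo.prod hK.isClosed.isOpen_compl).mem_nhds ⟨hsW, hy⟩] with p hp
      exact hfK _ _ hp.1 hp.2
    rw [this.fderiv_eq]
    simp
  have hcs : HasCompactSupport fun y => fderiv ℝ (fun p : ℝ × ℝ => f p.1 p.2) (t, y) :=
    HasCompactSupport.intro hK hzero
  have h3 := convolution_precompR_apply (L := ContinuousLinearMap.mul ℝ ℝ) (μ := volume) hk hcs
    hcont x (1, 0)
  refine (h2.congr_deriv ?_).congr_of_eventuallyEq (Eventually.of_forall fun t => ?_)
  · refine h3.trans ?_
    rw [convolution_eq_swap]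
    refine integral_congr_ae (Eventually.of_forall fun y => ?_)
    have h4 : HasFDerivAt (fun p : ℝ × ℝ => f p.1 p.2)
        (fderiv ℝ (fun p : ℝ × ℝ => f p.1 p.2) (t, y)) (t, y) :=
      ((hsm.contDiffAt (prod_univ_mem_nhds (p := (t, y)) hWo hsW)).differentiableAt
        (by simp)).hasFDerivAt
    have h5 : HasDerivAt (fun t : ℝ => (t, y)) ((1, 0) : ℝ × ℝ) t :=
      (hasDerivAt_id _).prodMk (hasDerivAt_const _ _)
    have h6 := (h4.comp_hasDerivAt t h5).deriv
    simp only [ContinuousLinearMap.mul_apply']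
    rw [← h6]
    rfl
  · simp [convolution_eq_swap]

theorem contDiffOn_integral {f : P → ℝ → ℝ} (hV : IsOpen V) (hf : IsTestFamily V f) :
    ContDiffOn ℝ ∞ (fun s => ∫ x, f s x) V := by
  have h := hf.contDiffOn_kernel hV (k := fun _ => 1) (locallyIntegrable_const _)
  have h2 := h.comp (f := fun s : P => (s, (0 : ℝ))) (s := V) (by fun_prop)
    fun s hs => ⟨hs, mem_univ _⟩
  simpa [Function.comp_def] using h2

theorem hasDerivAt_integral {V : Set ℝ} {f : ℝ → ℝ → ℝ} (hV : IsOpen V) (hf : IsTestFamily V f)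
    {t : ℝ} (ht : t ∈ V) :
    HasDerivAt (fun t => ∫ x, f t x) (∫ x, deriv (fun t => f t x) t) t := by
  simpa using hf.hasDerivAt_kernel hV (k := fun _ => 1) (locallyIntegrable_const _) ht 0

theorem hasDerivAt {V : Set ℝ} {f : ℝ → ℝ → E} (hV : IsOpen V) (hf : IsTestFamily V f)
    {t : ℝ} (ht : t ∈ V) (x : ℝ) :
    HasDerivAt (fun t => f t x) (deriv (fun t => f t x) t) t :=
  (((contDiffOn_slice hf.smooth x).contDiffAt (hV.mem_nhds ht)).differentiableAt
    (by simp)).hasDerivAt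

theorem integrable {f : P → ℝ → ℝ} (hf : IsTestFamily V f) {s : P} (hs : s ∈ V) :
    Integrable (f s) :=
  (hf.continuous hs).integrable_of_hasCompactSupport (hf.hasCompactSupport hs)

end IsTestFamily

/-! ### The nonlocal operator `(d/dx)⁻¹` -/

/-- The convolution kernel of `(d/dx)⁻¹`. -/
def signKernel (t : ℝ) : ℝ := if 0 ≤ t then 1 / 2 else -1 / 2

theorem locallyIntegrable_signKernel : LocallyIntegrable signKernel := by
  have hm : Measurable signKernel :=
    Measurable.ite measurableSet_Ici measurable_const measurable_const
  refine (locallyIntegrable_const (1 / 2 : ℝ)).mono hm.aestronglyMeasurable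
    (Eventually.of_forall fun t => ?_)
  unfold signKernel
  split_ifs <;> norm_num

/-- As a convolution, `invD` inherits joint smoothness and differentiation in parameters from the
kernel lemmas. -/
theorem invD_eq_integral {f : ℝ → ℝ} (hf : Integrable f) (x : ℝ) :
    invD f x = ∫ y, signKernel (x - y) * f y := by
  have hint : Integrable fun y => signKernel (x - y) * f y := by
    refine hf.bdd_mul (c := 1 / 2) ?_ (Eventually.of_forall fun t => ?_)
    · have hm : Measurable signKernel :=
        Measurable.ite measurableSet_Ici measurable_const measurable_const
      exact (hm.comp (measurable_const.sub measurable_id)).aestronglyMeasurable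
    · unfold signKernel
      split_ifs <;> norm_num
  rw [← integral_add_compl (measurableSet_Iic (a := x)) hint, compl_Iic]
  have h1 : ∫ y in Iic x, signKernel (x - y) * f y = ∫ y in Iic x, 1 / 2 * f y := by
    refine setIntegral_congr_fun measurableSet_Iic fun y hy => ?_
    have : 0 ≤ x - y := sub_nonneg.2 hy
    simp [signKernel, this]
  have h2 : ∫ y in Ioi x, signKernel (x - y) * f y = ∫ y in Ioi x, -1 / 2 * f y := by
    refine setIntegral_congr_fun measurableSet_Ioi fun y hy => ?_
    have : ¬ 0 ≤ x - y := not_le.2 (sub_neg.2 hy)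
    simp only [signKernel, if_neg this]
  rw [h1, h2, integral_const_mul, integral_const_mul, invD]
  ring

theorem IsTestFamily.contDiffOn_invD {V : Set P} {f : P → ℝ → ℝ} (hV : IsOpen V)
    (hf : IsTestFamily V f) :
    ContDiffOn ℝ ∞ (fun p : P × ℝ => invD (f p.1) p.2) (V ×ˢ univ) :=
  (hf.contDiffOn_kernel hV locallyIntegrable_signKernel).congr fun _ hp =>
    invD_eq_integral (hf.integrable hp.1) _

theorem IsTestFamily.hasDerivAt_invD {V : Set ℝ} {f : ℝ → ℝ → ℝ} (hV : IsOpen V)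
    (hf : IsTestFamily V f) {t : ℝ} (ht : t ∈ V) (x : ℝ)
    (hd : Integrable fun y => deriv (fun t => f t y) t) :
    HasDerivAt (fun t => invD (f t) x) (invD (fun y => deriv (fun t => f t y) t) x) t := by
  rw [invD_eq_integral hd]
  refine (hf.hasDerivAt_kernel hV locallyIntegrable_signKernel ht x).congr_of_eventuallyEq ?_
  filter_upwards [hV.mem_nhds ht] with s hs using invD_eq_integral (hf.integrable hs) x

/-- The two half-line integrals have constant sum, so half their difference changes with `x` exactly
as the integral over `Iic x` does. Both the derivative and the limits at infinity follow from this
form. -/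
theorem invD_eq_add {f : ℝ → ℝ} (hf : Integrable f) (x : ℝ) :
    invD f x = invD f 0 + ∫ y in (0 : ℝ)..x, f y := by
  have h1 := intervalIntegral.integral_Iic_sub_Iic (a := 0) (b := x)
    hf.integrableOn hf.integrableOn
  have h2 : ∀ a, (∫ y in Iic a, f y) + ∫ y in Ioi a, f y = ∫ y, f y := fun a =>
    intervalIntegral.integral_Iic_add_Ioi hf.integrableOn hf.integrableOn
  have h3 := h2 0
  have h4 := h2 x
  unfold invD
  linarith

theorem hasDerivAt_invD {f : ℝ → ℝ} (hf : Continuous f) (hi : Integrable f) (x : ℝ) :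
    HasDerivAt (invD f) (f x) x := by
  have h := (intervalIntegral.integral_hasDerivAt_right (hf.intervalIntegrable 0 x)
    (hf.stronglyMeasurableAtFilter _ _) hf.continuousAt).const_add (invD f 0)
  exact h.congr_of_eventuallyEq (Eventually.of_forall fun y => invD_eq_add hi y)

theorem invD_deriv {f : ℝ → ℝ} (hf : ContDiff ℝ 1 f) (hc : HasCompactSupport f) (x : ℝ) :
    invD (deriv f) x = f x := by
  rw [invD, hc.integral_Iic_deriv_eq hf, hc.integral_Ioi_deriv_eq hf]
  ring

theorem tendsto_invD_atTop {f : ℝ → ℝ} (hi : Integrable f) :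
    Tendsto (invD f) atTop (𝓝 ((∫ y, f y) / 2)) := by
  have h1 : Tendsto (fun x => ∫ y in (0 : ℝ)..x, f y) atTop (𝓝 (∫ y in Ioi 0, f y)) :=
    intervalIntegral_tendsto_integral_Ioi 0 hi.integrableOn tendsto_id
  have h2 := h1.const_add (invD f 0)
  have h3 : invD f 0 + ∫ y in Ioi 0, f y = (∫ y, f y) / 2 := by
    rw [← intervalIntegral.integral_Iic_add_Ioi (b := 0) hi.integrableOn hi.integrableOn, invD]
    ring
  rw [h3] at h2
  exact h2.congr fun x => (invD_eq_add hi x).symm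

theorem tendsto_invD_atBot {f : ℝ → ℝ} (hi : Integrable f) :
    Tendsto (invD f) atBot (𝓝 (-((∫ y, f y) / 2))) := by
  have h1 : Tendsto (fun x => ∫ y in x..(0 : ℝ), f y) atBot (𝓝 (∫ y in Iic 0, f y)) :=
    intervalIntegral_tendsto_integral_Iic 0 hi.integrableOn tendsto_id
  have h2 := h1.const_sub (invD f 0)
  have h3 : invD f 0 - ∫ y in Iic 0, f y = -((∫ y, f y) / 2) := by
    rw [← intervalIntegral.integral_Iic_add_Ioi (b := 0) hi.integrableOn hi.integrableOn, invD]
    ring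
  rw [h3] at h2
  refine h2.congr fun x => ?_
  rw [invD_eq_add hi x, intervalIntegral.integral_symm 0 x]
  ring

/-- The operator `(d/dx)⁻¹` is skew-symmetric. -/
theorem integral_mul_invD {p q : ℝ → ℝ} (hp : Continuous p) (hq : Continuous q)
    (hpc : HasCompactSupport p) (hqc : HasCompactSupport q) :
    ∫ x, p x * invD q x = -∫ x, q x * invD p x := by
  have ip := hp.integrable_of_hasCompactSupport (μ := volume) hpc
  have iq := hq.integrable_of_hasCompactSupport (μ := volume) hqc
  have dp := hasDerivAt_invD hp ip
  have dq := hasDerivAt_invD hq iq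
  have cp : Continuous (invD p) := continuous_iff_continuousAt.2 fun x => (dp x).continuousAt
  have cq : Continuous (invD q) := continuous_iff_continuousAt.2 fun x => (dq x).continuousAt
  have i1 : Integrable fun x => p x * invD q x :=
    (hp.mul cq).integrable_of_hasCompactSupport hpc.mul_right
  have i2 : Integrable fun x => q x * invD p x :=
    (hq.mul cp).integrable_of_hasCompactSupport hqc.mul_right
  -- The product of the two antiderivatives tends to `(∫ p)(∫ q) / 4` at both ends, the two signs at
  -- `-∞` cancelling, so integration by parts leaves no boundary term.
  have h := integral_of_hasDerivAt_of_tendsto (f := fun x => invD p x * invD q x)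
    (f' := fun x => p x * invD q x + q x * invD p x)
    (fun x => ((dp x).mul (dq x)).congr_deriv (by ring)) (i1.add i2)
    ((tendsto_invD_atBot ip).mul (tendsto_invD_atBot iq))
    ((tendsto_invD_atTop ip).mul (tendsto_invD_atTop iq))
  rw [integral_add i1 i2] at h
  linarith

end Calculus

/-! ### Families of fields, smooth functionals and their second variations -/

section Functionals

variable {P : Type*} [NormedAddCommGroup P] [NormedSpace ℝ P]
variable {Q : Type*} [NormedAddCommGroup Q] [NormedSpace ℝ Q]
variable {N : ℕ} {U : Set (Fin N → ℝ)}

theorem contDiffOn_dotProduct {s : Set P} {f g : P → Fin N → ℝ} (hf : ContDiffOn ℝ ∞ f s)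
    (hg : ContDiffOn ℝ ∞ g s) : ContDiffOn ℝ ∞ (fun p => f p ⬝ᵥ g p) s := by
  unfold dotProduct
  exact ContDiffOn.sum fun i _ => (contDiffOn_pi.1 hf i).mul (contDiffOn_pi.1 hg i)

theorem hasDerivAt_dotProduct {f g : ℝ → Fin N → ℝ} {f' g' : Fin N → ℝ} {t : ℝ}
    (hf : HasDerivAt f f' t) (hg : HasDerivAt g g' t) :
    HasDerivAt (fun t => f t ⬝ᵥ g t) (f' ⬝ᵥ g t + f t ⬝ᵥ g') t := by
  unfold dotProduct
  rw [← Finset.sum_add_distrib]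
  exact HasDerivAt.fun_sum fun i _ => (hasDerivAt_pi.1 hf i).mul (hasDerivAt_pi.1 hg i)

theorem IsTest.testFamily {h : ℝ → Fin N → ℝ} (hh : IsTest h) (V : Set P) :
    IsTestFamily V fun _ => h :=
  IsTestFamily.const hh.1 hh.2 V

theorem IsTestFamily.isTest {V : Set P} {f : P → ℝ → Fin N → ℝ} (hf : IsTestFamily V f) {s : P}
    (hs : s ∈ V) : IsTest (f s) :=
  ⟨hf.contDiff hs, hf.hasCompactSupport hs⟩

theorem IsTest.hasDerivAt {h : ℝ → Fin N → ℝ} (hh : IsTest h) (x : ℝ) :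
    HasDerivAt h (deriv h x) x :=
  (hh.1.differentiable (by simp) x).hasDerivAt

theorem IsField.hasDerivAt {u : ℝ → Fin N → ℝ} (hu : IsField U u) (x : ℝ) :
    HasDerivAt u (deriv u x) x :=
  (hu.1.differentiable (by simp) x).hasDerivAt

/-- The pairing with a test function has an integrable integrand. -/
theorem IsTest.integrable_dotProduct {φ h : ℝ → Fin N → ℝ} (hφ : IsTest φ) (hh : Continuous h) :
    Integrable fun x => φ x ⬝ᵥ h x := by
  refine Continuous.integrable_of_hasCompactSupport (hφ.1.continuous.dotProduct hh) ?_
  obtain ⟨R, hR⟩ := exists_bound_of_hasCompactSupport hφ.2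
  exact hasCompactSupport_of_bound (R := R) fun x hx => by simp [hR x hx]

/-- A smooth family of fields with parameter in an open subset of a normed space. -/
structure IsFieldFamily (U : Set (Fin N → ℝ)) (V : Set P) (γ : P → ℝ → Fin N → ℝ) : Prop where
  isOpen : IsOpen V
  isField : ∀ s ∈ V, IsField U (γ s)
  smooth : ContDiffOn ℝ ∞ (fun p : P × ℝ => γ p.1 p.2) (V ×ˢ univ)
  locally_fixed : ∀ s₀ ∈ V, ∃ R : ℝ, ∀ᶠ s in 𝓝 s₀, ∀ x : ℝ, R < |x| → γ s x = γ s₀ x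

namespace IsFieldFamily

variable {V : Set P} {γ : P → ℝ → Fin N → ℝ}

theorem comp (hγ : IsFieldFamily U V γ) {W : Set Q} (hW : IsOpen W) {L : Q → P}
    (hL : ContDiff ℝ ∞ L) (hLW : MapsTo L W V) : IsFieldFamily U W fun q => γ (L q) := by
  refine ⟨hW, fun s hs => hγ.isField _ (hLW hs),
    hγ.smooth.comp (f := fun p : Q × ℝ => (L p.1, p.2)) (by fun_prop)
    fun p hp => ⟨hLW hp.1, mem_univ _⟩, fun s₀ hs₀ => ?_⟩
  obtain ⟨R, hR⟩ := hγ.locally_fixed _ (hLW hs₀)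
  exact ⟨R, hL.continuous.continuousAt.eventually hR⟩

theorem const {u : ℝ → Fin N → ℝ} (hu : IsField U u) :
    IsFieldFamily U (univ : Set P) fun _ => u :=
  ⟨isOpen_univ, fun _ _ => hu, (hu.1.comp contDiff_snd).contDiffOn,
    fun _ _ => ⟨0, Eventually.of_forall fun _ _ _ => rfl⟩⟩

/-- Moving the members of a family of fields along a family of variations. -/
theorem add_smul (hγ : IsFieldFamily U V γ) (hU : IsOpen U) {v : P → ℝ → Fin N → ℝ}
    (hv : IsTestFamily V v) :
    IsFieldFamily U {p : P × ℝ | p.1 ∈ V ∧ ∀ x, γ p.1 x + p.2 • v p.1 x ∈ U}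
      fun p => γ p.1 + p.2 • v p.1 := by
  have hsm : ContDiffOn ℝ ∞ (fun p : (P × ℝ) × ℝ => γ p.1.1 p.2 + p.1.2 • v p.1.1 p.2)
      ((V ×ˢ univ) ×ˢ univ) := by
    have h1 := hγ.smooth.comp (f := fun p : (P × ℝ) × ℝ => (p.1.1, p.2))
      (s := (V ×ˢ univ) ×ˢ univ) (by fun_prop) fun p hp => ⟨hp.1.1, mem_univ _⟩
    have h2 := hv.smooth.comp (f := fun p : (P × ℝ) × ℝ => (p.1.1, p.2))
      (s := (V ×ˢ univ) ×ˢ univ) (by fun_prop) fun p hp => ⟨hp.1.1, mem_univ _⟩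
    have h3 : ContDiffOn ℝ ∞ (fun p : (P × ℝ) × ℝ => p.1.2) ((V ×ˢ univ) ×ˢ univ) := by fun_prop
    exact h1.add (h3.smul h2)
  have hfix : ∀ s₀ ∈ V, ∃ R : ℝ, ∀ᶠ s in 𝓝 s₀, ∀ x : ℝ, R < |x| →
      γ s x = γ s₀ x ∧ v s x = 0 := by
    intro s₀ hs₀
    obtain ⟨R, hR⟩ := hγ.locally_fixed s₀ hs₀
    obtain ⟨R', hR'⟩ := hv.support s₀ hs₀
    refine ⟨max R R', ?_⟩
    filter_upwards [hR, hR'] with s h h' x hx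
    exact ⟨h x (lt_of_le_of_lt (le_max_left _ _) hx), h' x (lt_of_le_of_lt (le_max_right _ _) hx)⟩
  refine ⟨?_, ?_, ?_, ?_⟩
  · rw [isOpen_iff_mem_nhds]
    rintro ⟨s₀, r₀⟩ ⟨hs₀, hU₀⟩
    obtain ⟨R, hR⟩ := hfix s₀ hs₀
    -- Staying inside `U` is an open condition over the compact interval `[-R, R]`; outside it the
    -- moved field coincides with `γ s₀`, which is already a field.
    have hcomp : ∀ᶠ p in 𝓝 (s₀, r₀), ∀ x ∈ Icc (-R) R, γ p.1 x + p.2 • v p.1 x ∈ U := by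
      refine isCompact_Icc.eventually_forall_of_forall_eventually fun x _ => ?_
      have hc : ContinuousAt (fun p : (P × ℝ) × ℝ => γ p.1.1 p.2 + p.1.2 • v p.1.1 p.2)
          ((s₀, r₀), x) :=
        hsm.continuousOn.continuousAt
          (((hγ.isOpen.prod isOpen_univ).prod isOpen_univ).mem_nhds
            ⟨⟨hs₀, mem_univ _⟩, mem_univ _⟩)
      exact hc.eventually (hU.mem_nhds (hU₀ x))
    have hV' : ∀ᶠ p in 𝓝 (s₀, r₀), p.1 ∈ V :=
      continuousAt_fst.eventually (hγ.isOpen.mem_nhds hs₀)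
    have hR' : ∀ᶠ p in 𝓝 (s₀, r₀), ∀ x : ℝ, R < |x| → γ p.1 x = γ s₀ x ∧ v p.1 x = 0 :=
      (continuousAt_fst (p := (s₀, r₀))).eventually hR
    filter_upwards [hcomp, hV', hR'] with p h1 h2 h3
    refine ⟨h2, fun x => ?_⟩
    by_cases hx : R < |x|
    · rw [(h3 x hx).1, (h3 x hx).2, smul_zero, add_zero]
      exact (hγ.isField s₀ hs₀).2.1 x
    · exact h1 x (abs_le.1 (not_lt.1 hx))
  · rintro ⟨s, r⟩ ⟨hs, hsU⟩
    have hγs := hγ.isField s hs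
    have hvs := hv.isTest hs
    refine ⟨hγs.1.add (contDiff_const.smul hvs.1), hsU, ?_⟩
    have : deriv (γ s + r • v s) = deriv (γ s) + r • deriv (v s) := by
      funext x
      exact ((hγs.hasDerivAt x).add ((hvs.hasDerivAt x).const_smul r)).deriv
    simp only [this]
    exact hγs.2.2.add (hvs.2.deriv.smul_left (f := fun _ => r))
  · exact hsm.mono fun p hp => ⟨⟨hp.1.1, mem_univ _⟩, mem_univ _⟩
  · rintro ⟨s₀, r₀⟩ ⟨hs₀, hU₀⟩
    obtain ⟨R, hR⟩ := hfix s₀ hs₀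
    refine ⟨R, ?_⟩
    have hR' : ∀ᶠ p in 𝓝 (s₀, r₀), ∀ x : ℝ, R < |x| → γ p.1 x = γ s₀ x ∧ v p.1 x = 0 :=
      (continuousAt_fst (p := (s₀, r₀))).eventually hR
    filter_upwards [hR'] with p hp x hx
    have h0 := hR.self_of_nhds x hx
    simp [(hp x hx).1, (hp x hx).2, h0.2]

end IsFieldFamily

/-- The parameters for which the line through `u` in the direction `h` consists of fields. -/
def lineDomain (U : Set (Fin N → ℝ)) (u h : ℝ → Fin N → ℝ) : Set ℝ :=
  {t | ∀ x, u x + t • h x ∈ U}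

theorem IsField.line {u h : ℝ → Fin N → ℝ} (hu : IsField U u) (hU : IsOpen U) (hh : IsTest h) :
    IsFieldFamily U (lineDomain U u h) fun t => u + t • h := by
  have h1 := (IsFieldFamily.const (P := ℝ) hu).add_smul hU (hh.testFamily univ)
  have hL : ContDiff ℝ ∞ fun t : ℝ => ((0 : ℝ), t) := by fun_prop
  have hpre : lineDomain U u h = (fun t : ℝ => ((0 : ℝ), t)) ⁻¹'
      {p : ℝ × ℝ | p.1 ∈ univ ∧ ∀ x, u x + p.2 • h x ∈ U} := by
    ext t
    simp [lineDomain]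
  rw [hpre]
  exact h1.comp (h1.isOpen.preimage hL.continuous) hL fun t ht => ht

theorem IsField.zero_mem_lineDomain {u : ℝ → Fin N → ℝ} (hu : IsField U u)
    (h : ℝ → Fin N → ℝ) : (0 : ℝ) ∈ lineDomain U u h := by
  intro x
  simpa using hu.2.1 x

/-- Testing against `φ - ψ` itself gives `∫ |φ - ψ|² = 0`, and the integrand is continuous and
nonnegative. -/
theorem HasVarDeriv.unique {F : (ℝ → Fin N → ℝ) → ℝ} {u φ ψ : ℝ → Fin N → ℝ}
    (hφ : HasVarDeriv F u φ) (hψ : HasVarDeriv F u ψ) : φ = ψ := by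
  have ht : IsTest (φ - ψ) := ⟨hφ.1.1.sub hψ.1.1, hφ.1.2.sub hψ.1.2⟩
  have h := (hφ.2 _ ht).unique (hψ.2 _ ht)
  have hc : Continuous (φ - ψ) := ht.1.continuous
  have h2 : ∫ x, (φ - ψ) x ⬝ᵥ (φ - ψ) x = 0 := by
    have i1 := hφ.1.integrable_dotProduct hc
    have i2 := hψ.1.integrable_dotProduct hc
    have : ∀ x, (φ - ψ) x ⬝ᵥ (φ - ψ) x = φ x ⬝ᵥ (φ - ψ) x - ψ x ⬝ᵥ (φ - ψ) x := fun x => by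
      rw [Pi.sub_apply φ ψ x, sub_dotProduct]
    simp_rw [this]
    rw [integral_sub i1 i2]
    exact sub_eq_zero.2 h
  have h3 : (fun x => (φ - ψ) x ⬝ᵥ (φ - ψ) x) = 0 := by
    have hd : Continuous fun x => (φ - ψ) x ⬝ᵥ (φ - ψ) x := hc.dotProduct hc
    have h0 := (integral_eq_zero_iff_of_nonneg
      (fun x => Finset.sum_nonneg fun i _ => mul_self_nonneg ((φ - ψ) x i))
      (ht.integrable_dotProduct hc)).1 h2
    exact (hd.ae_eq_iff_eq volume continuous_zero).1 h0
  funext x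
  have := congrFun h3 x
  exact sub_eq_zero.1 (dotProduct_self_eq_zero.1 this)

theorem HasVarDeriv.varDeriv_eq {F : (ℝ → Fin N → ℝ) → ℝ} {u φ : ℝ → Fin N → ℝ}
    (hφ : HasVarDeriv F u φ) : varDeriv F u = φ := by
  have h : ∃ φ, HasVarDeriv F u φ := ⟨φ, hφ⟩
  rw [varDeriv, dif_pos h]
  exact h.choose_spec.unique hφ

/-- The derivative in the direction `v` of the variational derivative of `I`. -/
def secondVar (I : (ℝ → Fin N → ℝ) → ℝ) (u v : ℝ → Fin N → ℝ) (x : ℝ) : Fin N → ℝ :=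
  deriv (fun t : ℝ => varDeriv I (u + t • v) x) 0

namespace IsFunctional

variable {I : (ℝ → Fin N → ℝ) → ℝ}

theorem hasVarDeriv (hI : IsFunctional U I) {u : ℝ → Fin N → ℝ} (hu : IsField U u) :
    HasVarDeriv I u (varDeriv I u) := by
  obtain ⟨φ, hφ⟩ := hI.exists_varDeriv u hu
  rwa [hφ.varDeriv_eq]

theorem isTest (hI : IsFunctional U I) {u : ℝ → Fin N → ℝ} (hu : IsField U u) :
    IsTest (varDeriv I u) :=
  (hI.hasVarDeriv hu).1

variable [FiniteDimensional ℝ P] {V : Set P} {γ : P → ℝ → Fin N → ℝ}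

/-- The definition of a smooth functional speaks of parameters in `Fin m → ℝ`; a linear isomorphism
carries it to any finite-dimensional space, in particular to products with an extra time variable.
-/
theorem contDiffOn_family (hI : IsFunctional U I) (hγ : IsFieldFamily U V γ) :
    ContDiffOn ℝ ∞ (fun s => I (γ s)) V := by
  let e : P ≃L[ℝ] (Fin (Module.finrank ℝ P) → ℝ) := ContinuousLinearEquiv.ofFinrankEq (by simp)
  have h1 : IsFieldFamily U (e.symm ⁻¹' V) fun s => γ (e.symm s) :=
    hγ.comp (hγ.isOpen.preimage e.symm.continuous) e.symm.contDiff fun s hs => hs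
  have h2 := hI.smooth _ _ _ ⟨h1.isOpen, h1.isField, h1.smooth, h1.locally_fixed⟩
  have h3 := h2.comp (f := e) (s := V) e.contDiff.contDiffOn fun s hs => by simpa using hs
  simpa [Function.comp_def] using h3

theorem testFamily (hI : IsFunctional U I) (hγ : IsFieldFamily U V γ) :
    IsTestFamily V fun s => varDeriv I (γ s) := by
  let e : P ≃L[ℝ] (Fin (Module.finrank ℝ P) → ℝ) := ContinuousLinearEquiv.ofFinrankEq (by simp)
  have h1 : IsFieldFamily U (e.symm ⁻¹' V) fun s => γ (e.symm s) :=
    hγ.comp (hγ.isOpen.preimage e.symm.continuous) e.symm.contDiff fun s hs => hs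
  have h2 : IsSmoothFamily U (e.symm ⁻¹' V) fun s => γ (e.symm s) :=
    ⟨h1.isOpen, h1.isField, h1.smooth, h1.locally_fixed⟩
  have h3 : IsTestFamily (e.symm ⁻¹' V) fun s => varDeriv I (γ (e.symm s)) :=
    ⟨hI.smooth_varDeriv _ _ _ h2, hI.support_varDeriv _ _ _ h2⟩
  have h4 := h3.comp (W := V) (L := e) e.contDiff fun s hs => by simpa using hs
  simpa using h4

/-- Time is adjoined as one more parameter, `(s, t) ↦ γ s + t • v s`, and the smooth family of
variational derivatives is differentiated at `t = 0`. This is why functionals are tested on families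
of arbitrary finite dimension. -/
theorem secondVar_testFamily (hI : IsFunctional U I) (hU : IsOpen U) (hγ : IsFieldFamily U V γ)
    {v : P → ℝ → Fin N → ℝ} (hv : IsTestFamily V v) :
    IsTestFamily V fun s => secondVar I (γ s) (v s) := by
  have h1 := hγ.add_smul hU hv
  have h2 := hI.testFamily h1
  have hmem : ∀ s ∈ V, (s, (0 : ℝ)) ∈ {p : P × ℝ | p.1 ∈ V ∧ ∀ x, γ p.1 x + p.2 • v p.1 x ∈ U} :=
    fun s hs => ⟨hs, fun x => by simpa using (hγ.isField s hs).2.1 x⟩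
  have h3 := contDiffOn_deriv_param (f := fun p x => varDeriv I (γ p.1 + p.2 • v p.1) x)
    h1.isOpen h2.smooth
  refine ⟨h3.mono fun p hp => ⟨hmem _ hp.1, mem_univ _⟩, fun s₀ hs₀ => ?_⟩
  obtain ⟨R, hR⟩ := h2.support _ (hmem s₀ hs₀)
  refine ⟨R, ?_⟩
  -- The bound `R` holds near `(s₀, 0)`, hence for each `s` near `s₀` and then for all small `t`; so
  -- the derivative in `t` vanishes beyond the same `R`.
  filter_upwards [hR.curry_nhds] with s hs x hx
  have : (fun t : ℝ => varDeriv I (γ s + t • v s) x) =ᶠ[𝓝 0] fun _ => 0 :=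
    hs.mono fun t ht => ht x hx
  rw [secondVar, this.deriv_eq]
  simp

theorem secondVar_isTest (hI : IsFunctional U I) (hU : IsOpen U) {u v : ℝ → Fin N → ℝ}
    (hu : IsField U u) (hv : IsTest v) : IsTest (secondVar I u v) :=
  (hI.secondVar_testFamily hU (IsFieldFamily.const (P := ℝ) hu) (hv.testFamily univ)).isTest
    (mem_univ 0)

/-- Differentiating the first variation in the direction `v` along the direction `h`. -/
theorem hasDerivAt_firstVar (hI : IsFunctional U I) (hU : IsOpen U) {u v h : ℝ → Fin N → ℝ}
    (hu : IsField U u) (hv : IsTest v) (hh : IsTest h) :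
    HasDerivAt (fun s : ℝ => ∫ x, varDeriv I (u + s • h) x ⬝ᵥ v x)
      (∫ x, secondVar I u h x ⬝ᵥ v x) 0 := by
  have hl := hu.line hU hh
  have ht := hI.testFamily hl
  have hf : IsTestFamily (lineDomain U u h)
      fun (s : ℝ) (x : ℝ) => varDeriv I (u + s • h) x ⬝ᵥ v x :=
    ht.of_eq_zero hl.isOpen
      (contDiffOn_dotProduct ht.smooth (hv.testFamily (lineDomain U u h)).smooth)
      fun s _ x hx => by simp [hx]
  have h0 := hu.zero_mem_lineDomain h
  refine (hf.hasDerivAt_integral hl.isOpen h0).congr_deriv ?_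
  refine integral_congr_ae (Eventually.of_forall fun x => ?_)
  have h1 := hasDerivAt_dotProduct (ht.hasDerivAt hl.isOpen h0 x) (hasDerivAt_const (0 : ℝ) (v x))
  rw [dotProduct_zero, add_zero] at h1
  exact h1.deriv

/-- Both sides are the mixed second derivative of `I (u + s • h + t • v)` at the origin, taken in
the two orders. -/
theorem integral_secondVar_comm (hI : IsFunctional U I) (hU : IsOpen U) {u v h : ℝ → Fin N → ℝ}
    (hu : IsField U u) (hv : IsTest v) (hh : IsTest h) :
    ∫ x, secondVar I u h x ⬝ᵥ v x = ∫ x, secondVar I u v x ⬝ᵥ h x := by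
  have hl := hu.line hU hh
  have hfam := hl.add_smul hU (hv.testFamily (lineDomain U u h))
  have h00 : ((0 : ℝ), (0 : ℝ)) ∈ {p : ℝ × ℝ | p.1 ∈ lineDomain U u h ∧
      ∀ x, (u + p.1 • h) x + p.2 • v x ∈ U} :=
    ⟨hu.zero_mem_lineDomain h, fun x => by simpa using hu.2.1 x⟩
  have hsm := (hI.contDiffOn_family hfam).contDiffAt (hfam.isOpen.mem_nhds h00)
  have hcomm := deriv_deriv_comm (f := fun s t => I (u + s • h + t • v)) (a := 0) (b := 0)
    (hsm.of_le (WithTop.coe_le_coe.2 (le_top : (2 : ℕ∞) ≤ ⊤)))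
  have e1 : (fun s : ℝ => deriv (fun t : ℝ => I (u + s • h + t • v)) 0) =ᶠ[𝓝 0]
      fun s : ℝ => ∫ x, varDeriv I (u + s • h) x ⬝ᵥ v x := by
    filter_upwards [hl.isOpen.mem_nhds (hu.zero_mem_lineDomain h)] with s hs
    exact ((hI.hasVarDeriv (hl.isField s hs)).2 v hv).deriv
  have hl' := hu.line hU hv
  have e2 : (fun t : ℝ => deriv (fun s : ℝ => I (u + s • h + t • v)) 0) =ᶠ[𝓝 0]
      fun t : ℝ => ∫ x, varDeriv I (u + t • v) x ⬝ᵥ h x := by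
    filter_upwards [hl'.isOpen.mem_nhds (hu.zero_mem_lineDomain v)] with t ht
    have := ((hI.hasVarDeriv (hl'.isField t ht)).2 h hh).deriv
    refine Eq.trans ?_ this
    congr 1
    funext s
    rw [add_right_comm]
  rw [e1.deriv_eq, e2.deriv_eq, (hI.hasDerivAt_firstVar hU hu hv hh).deriv,
    (hI.hasDerivAt_firstVar hU hu hh hv).deriv] at hcomm
  exact hcomm

end IsFunctional

/-- The linear functional `∫ aᵢ(x) uⁱ(x) dx`. -/
def linearFunctional (a u : ℝ → Fin N → ℝ) : ℝ := ∫ x, a x ⬝ᵥ u x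

theorem hasVarDeriv_linearFunctional {a u : ℝ → Fin N → ℝ} (ha : IsTest a) (hu : IsField U u) :
    HasVarDeriv (linearFunctional a) u a := by
  refine ⟨ha, fun h hh => ?_⟩
  have i1 := ha.integrable_dotProduct hu.1.continuous
  have i2 := ha.integrable_dotProduct hh.1.continuous
  have : (fun t : ℝ => linearFunctional a (u + t • h)) =
      fun t : ℝ => (∫ x, a x ⬝ᵥ u x) + t * ∫ x, a x ⬝ᵥ h x := by
    funext t
    rw [← integral_const_mul, ← integral_add i1 (i2.const_mul t)]
    refine integral_congr_ae (Eventually.of_forall fun x => ?_)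
    simp [dotProduct_add, dotProduct_smul]
  rw [this]
  exact (((hasDerivAt_id (0 : ℝ)).mul_const (∫ x, a x ⬝ᵥ h x)).const_add
    (∫ x, a x ⬝ᵥ u x)).congr_deriv (one_mul _)

/-- The variational derivative is `a` at every field, so any test covector occurs as a variational
derivative; necessity of the two systems rests on this supply of functionals. -/
theorem isFunctional_linearFunctional {a : ℝ → Fin N → ℝ} (ha : IsTest a) :
    IsFunctional U (linearFunctional a) := by
  have hvd : ∀ u, IsField U u → varDeriv (linearFunctional a) u = a := fun u hu =>
    (hasVarDeriv_linearFunctional ha hu).varDeriv_eq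
  refine ⟨fun u hu => ⟨a, hasVarDeriv_linearFunctional ha hu⟩, ?_, ?_, ?_⟩
  · intro m V γ hγ
    have hat := ha.testFamily V
    have : IsTestFamily V fun s x => a x ⬝ᵥ γ s x :=
      hat.of_eq_zero hγ.isOpen (contDiffOn_dotProduct hat.smooth hγ.smooth)
        fun s _ x hx => by simp [hx]
    exact this.contDiffOn_integral hγ.isOpen
  · intro m V γ hγ
    refine (ha.testFamily V).smooth.congr fun p hp => ?_
    rw [hvd _ (hγ.isField _ hp.1)]
  · intro m V γ hγ s₀ hs₀
    obtain ⟨R, hR⟩ := exists_bound_of_hasCompactSupport ha.2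
    refine ⟨R, ?_⟩
    filter_upwards [hγ.isOpen.mem_nhds hs₀] with s hs x hx
    rw [hvd _ (hγ.isField _ hs), hR x hx]

end Functionals

/-! ### The Hamiltonian operator and its skew form -/

section Operator

variable {P : Type*} [NormedAddCommGroup P] [NormedSpace ℝ P]
variable {N : ℕ} {U : Set (Fin N → ℝ)}

theorem contDiffOn_mulVec {s : Set P} {A : P → Matrix (Fin N) (Fin N) ℝ} {v : P → Fin N → ℝ}
    (hA : ∀ i j, ContDiffOn ℝ ∞ (fun p => A p i j) s) (hv : ContDiffOn ℝ ∞ v s) :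
    ContDiffOn ℝ ∞ (fun p => A p *ᵥ v p) s :=
  contDiffOn_pi.2 fun i => by
    simp only [mulVec, dotProduct]
    exact ContDiffOn.sum fun j _ => (hA i j).mul (contDiffOn_pi.1 hv j)

theorem contDiffOn_const_mulVec {s : Set P} (A : Matrix (Fin N) (Fin N) ℝ) {v : P → Fin N → ℝ}
    (hv : ContDiffOn ℝ ∞ v s) : ContDiffOn ℝ ∞ (fun p => A *ᵥ v p) s :=
  contDiffOn_mulVec (A := fun _ => A) (fun _ _ => contDiffOn_const) hv

theorem hasDerivAt_const_mulVec (A : Matrix (Fin N) (Fin N) ℝ) {v : ℝ → Fin N → ℝ}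
    {v' : Fin N → ℝ} {t : ℝ} (hv : HasDerivAt v v' t) :
    HasDerivAt (fun t => A *ᵥ v t) (A *ᵥ v') t :=
  hasDerivAt_pi.2 fun i => by
    simp only [mulVec, dotProduct]
    exact HasDerivAt.fun_sum fun j _ => (hasDerivAt_pi.1 hv j).const_mul (A i j)

theorem contDiffOn_pd (hU : IsOpen U) {f : (Fin N → ℝ) → ℝ} (hf : ContDiffOn ℝ ∞ f U)
    (k : Fin N) : ContDiffOn ℝ ∞ (pd k f) U :=
  (hf.fderiv_of_isOpen hU (m := ∞) (by simp)).clm_apply contDiffOn_const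

theorem fderiv_eq_sum_pd (f : (Fin N → ℝ) → ℝ) (u v : Fin N → ℝ) :
    fderiv ℝ f u v = ∑ k, v k * pd k f u := by
  conv_lhs => rw [pi_eq_sum_univ' v]
  simp [pd]

theorem pd_comm (hU : IsOpen U) {f : (Fin N → ℝ) → ℝ} (hf : ContDiffOn ℝ ∞ f U)
    {u : Fin N → ℝ} (hu : u ∈ U) (k s : Fin N) : pd k (pd s f) u = pd s (pd k f) u := by
  have hfu : ContDiffAt ℝ ∞ f u := hf.contDiffAt (hU.mem_nhds hu)
  have hd : DifferentiableAt ℝ (fderiv ℝ f) u :=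
    (hfu.fderiv_right (m := 1) (WithTop.coe_le_coe.2 (le_top : (1 + 1 : ℕ∞) ≤ ⊤))).differentiableAt
      (by simp)
  have hsymm : IsSymmSndFDerivAt ℝ f u :=
    hfu.isSymmSndFDerivAt (by simpa using WithTop.coe_le_coe.2 (le_top : (2 : ℕ∞) ≤ ⊤))
  have h : ∀ a b : Fin N,
      pd a (pd b f) u = fderiv ℝ (fderiv ℝ f) u (Pi.single a 1) (Pi.single b 1) := by
    intro a b
    have h1 : HasFDerivAt (pd b f) ((ContinuousLinearMap.apply ℝ ℝ
        (Pi.single b (1 : ℝ) : Fin N → ℝ)).comp (fderiv ℝ (fderiv ℝ f) u)) u :=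
      (ContinuousLinearMap.apply ℝ ℝ (Pi.single b (1 : ℝ) : Fin N → ℝ)).hasFDerivAt.comp u
        hd.hasFDerivAt
    rw [pd, h1.fderiv]
    rfl
  rw [h, h]
  exact hsymm _ _

/-- The Jacobian matrix `(∂Hʲ/∂uˢ)`, with row index `j`. -/
def jac (H : Fin N → (Fin N → ℝ) → ℝ) (u : Fin N → ℝ) : Matrix (Fin N) (Fin N) ℝ :=
  Matrix.of fun j s => pd s (H j) u

/-- The Hessian matrix `(∂²f/∂uᵏ∂uˢ)`. -/
def hess (f : (Fin N → ℝ) → ℝ) (u : Fin N → ℝ) : Matrix (Fin N) (Fin N) ℝ :=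
  Matrix.of fun k s => pd k (pd s f) u

/-- The Hessian of `H` contracted with the covector `ξ`. -/
def hessSum (H : Fin N → (Fin N → ℝ) → ℝ) (u ξ : Fin N → ℝ) : Matrix (Fin N) (Fin N) ℝ :=
  ∑ j, ξ j • hess (H j) u

theorem dotProduct_hessSum_mulVec (H : Fin N → (Fin N → ℝ) → ℝ) (u ξ a b : Fin N → ℝ) :
    a ⬝ᵥ (hessSum H u ξ *ᵥ b) = ∑ j, ξ j * (a ⬝ᵥ (hess (H j) u *ᵥ b)) := by
  simp [hessSum, sum_mulVec, smul_mulVec, dotProduct_sum, dotProduct_smul]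

theorem hessSum_apply (H : Fin N → (Fin N → ℝ) → ℝ) (u ξ : Fin N → ℝ) (k s : Fin N) :
    hessSum H u ξ k s = ∑ j, ξ j * pd k (pd s (H j)) u := by
  simp [hessSum, hess, Matrix.sum_apply]

theorem transpose_hessSum (hU : IsOpen U) {H : Fin N → (Fin N → ℝ) → ℝ}
    (hH : ∀ i, ContDiffOn ℝ ∞ (H i) U) {u : Fin N → ℝ} (hu : u ∈ U) (ξ : Fin N → ℝ) :
    (hessSum H u ξ)ᵀ = hessSum H u ξ := by
  ext k s
  simp only [transpose_apply, hessSum_apply]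
  exact Finset.sum_congr rfl fun j _ => by rw [pd_comm hU (hH j) hu]

/-- Derivative of `ξ · (∂H(c) w)` along a curve. -/
theorem hasDerivAt_dotProduct_jac (hU : IsOpen U) {H : Fin N → (Fin N → ℝ) → ℝ}
    (hH : ∀ i, ContDiffOn ℝ ∞ (H i) U) {ξ c w : ℝ → Fin N → ℝ} {ξ' c' w' : Fin N → ℝ} {t : ℝ}
    (hξ : HasDerivAt ξ ξ' t) (hc : HasDerivAt c c' t) (hw : HasDerivAt w w' t) (hcU : c t ∈ U) :
    HasDerivAt (fun t => ξ t ⬝ᵥ (jac H (c t) *ᵥ w t))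
      (ξ' ⬝ᵥ (jac H (c t) *ᵥ w t) + c' ⬝ᵥ (hessSum H (c t) (ξ t) *ᵥ w t)
        + ξ t ⬝ᵥ (jac H (c t) *ᵥ w')) t := by
  have h1 : ∀ j s, HasDerivAt (fun t => jac H (c t) j s) (∑ k, c' k * hess (H j) (c t) k s) t := by
    intro j s
    have hd : HasFDerivAt (pd s (H j)) (fderiv ℝ (pd s (H j)) (c t)) (c t) :=
      (((contDiffOn_pd hU (hH j) s).contDiffAt (hU.mem_nhds hcU)).differentiableAt
        (by simp)).hasFDerivAt
    have := hd.comp_hasDerivAt t hc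
    rw [fderiv_eq_sum_pd] at this
    exact this
  have h2 : HasDerivAt (fun t => jac H (c t) *ᵥ w t)
      ((fun j => c' ⬝ᵥ (hess (H j) (c t) *ᵥ w t)) + jac H (c t) *ᵥ w') t := by
    refine hasDerivAt_pi.2 fun j => ?_
    have h3 : HasDerivAt (fun t => ∑ s, jac H (c t) j s * w t s)
        (∑ s, ((∑ k, c' k * hess (H j) (c t) k s) * w t s + jac H (c t) j s * w' s)) t :=
      HasDerivAt.fun_sum fun s _ => (h1 j s).mul (hasDerivAt_pi.1 hw s)
    refine h3.congr_deriv ?_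
    rw [Finset.sum_add_distrib, Pi.add_apply]
    congr 1
    rw [dotProduct_mulVec]
    rfl
  refine (hasDerivAt_dotProduct hξ h2).congr_deriv ?_
  rw [dotProduct_add, dotProduct_hessSum_mulVec, add_assoc]
  rfl

/-- The potential `(d/dx)⁻¹ (uⁱ ξᵢ,ₓ)`. -/
def potential (u ξ : ℝ → Fin N → ℝ) : ℝ → ℝ := invD fun y => u y ⬝ᵥ deriv ξ y

/-- A skew-symmetric density of the bracket, free of derivatives of `u`. -/
def formDensity (η : Matrix (Fin N) (Fin N) ℝ) (K : ℝ) (H : Fin N → (Fin N → ℝ) → ℝ)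
    (u ξ ζ : ℝ → Fin N → ℝ) (x : ℝ) : ℝ :=
  ξ x ⬝ᵥ (jac H (u x) *ᵥ (η *ᵥ deriv ζ x)) - ζ x ⬝ᵥ (jac H (u x) *ᵥ (η *ᵥ deriv ξ x))
    + K * ((u x ⬝ᵥ deriv ξ x) * potential u ζ x)

/-- The variational derivative of `∫ formDensity` with respect to `u`, for fixed covectors. -/
def formGrad (η : Matrix (Fin N) (Fin N) ℝ) (K : ℝ) (H : Fin N → (Fin N → ℝ) → ℝ)
    (u ξ ζ : ℝ → Fin N → ℝ) (x : ℝ) : Fin N → ℝ :=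
  hessSum H (u x) (ξ x) *ᵥ (η *ᵥ deriv ζ x) - hessSum H (u x) (ζ x) *ᵥ (η *ᵥ deriv ξ x)
    + (K * potential u ζ x) • deriv ξ x - (K * potential u ξ x) • deriv ζ x

/-- The Hamiltonian operator applied to the covector `ζ`. -/
def flow (η : Matrix (Fin N) (Fin N) ℝ) (K : ℝ) (H : Fin N → (Fin N → ℝ) → ℝ)
    (u ζ : ℝ → Fin N → ℝ) (x : ℝ) : Fin N → ℝ :=
  Matrix.of (canonicalMetric η K H (u x)) *ᵥ deriv ζ x
    + η *ᵥ (hessSum H (u x) (ζ x) *ᵥ deriv u x) - (K * potential u ζ x) • deriv u x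

/-! ### Smooth dependence on parameters -/

section Families

variable {V : Set P} {γ ξ ζ : P → ℝ → Fin N → ℝ} {η : Matrix (Fin N) (Fin N) ℝ} {K : ℝ}
  {H : Fin N → (Fin N → ℝ) → ℝ}

theorem IsFieldFamily.contDiffOn_comp (hγ : IsFieldFamily U V γ) {f : (Fin N → ℝ) → ℝ}
    (hf : ContDiffOn ℝ ∞ f U) :
    ContDiffOn ℝ ∞ (fun p : P × ℝ => f (γ p.1 p.2)) (V ×ˢ univ) :=
  hf.comp hγ.smooth fun _ hp => (hγ.isField _ hp.1).2.1 _

theorem IsFieldFamily.contDiffOn_jac (hγ : IsFieldFamily U V γ) (hU : IsOpen U)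
    (hH : ∀ i, ContDiffOn ℝ ∞ (H i) U) (i j : Fin N) :
    ContDiffOn ℝ ∞ (fun p : P × ℝ => jac H (γ p.1 p.2) i j) (V ×ˢ univ) :=
  hγ.contDiffOn_comp (contDiffOn_pd hU (hH i) j)

theorem IsFieldFamily.contDiffOn_hessSum (hγ : IsFieldFamily U V γ) (hU : IsOpen U)
    (hH : ∀ i, ContDiffOn ℝ ∞ (H i) U) (hξ : IsTestFamily V ξ) (i j : Fin N) :
    ContDiffOn ℝ ∞ (fun p : P × ℝ => hessSum H (γ p.1 p.2) (ξ p.1 p.2) i j) (V ×ˢ univ) := by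
  simp only [hessSum_apply]
  exact ContDiffOn.sum fun k _ => (contDiffOn_pi.1 hξ.smooth k).mul
    (hγ.contDiffOn_comp (contDiffOn_pd hU (contDiffOn_pd hU (hH k) j) i))

theorem contDiffOn_canonicalMetric (hU : IsOpen U) (hH : ∀ i, ContDiffOn ℝ ∞ (H i) U)
    (i j : Fin N) : ContDiffOn ℝ ∞ (fun u => canonicalMetric η K H u i j) U := by
  unfold canonicalMetric
  have hc : ∀ i : Fin N, ContDiffOn ℝ ∞ (fun u : Fin N → ℝ => u i) U := fun i => by fun_prop
  exact ((ContDiffOn.sum fun s _ => contDiffOn_const.mul (contDiffOn_pd hU (hH j) s)).add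
    (ContDiffOn.sum fun s _ => contDiffOn_const.mul (contDiffOn_pd hU (hH i) s))).sub
    ((contDiffOn_const.mul (hc i)).mul (hc j))

/-- The fields need not decay; compact support comes from the derivative of the covector, which
makes the potential well defined and smooth in the parameters. -/
theorem IsFieldFamily.dotProduct_deriv (hγ : IsFieldFamily U V γ) (hξ : IsTestFamily V ξ) :
    IsTestFamily V fun s x => γ s x ⬝ᵥ deriv (ξ s) x := by
  have hξ' := hξ.derivX hγ.isOpen
  exact hξ'.of_eq_zero hγ.isOpen (contDiffOn_dotProduct hγ.smooth hξ'.smooth)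
    fun s _ x hx => by simp [hx]

theorem IsFieldFamily.contDiffOn_potential (hγ : IsFieldFamily U V γ) (hξ : IsTestFamily V ξ) :
    ContDiffOn ℝ ∞ (fun p : P × ℝ => potential (γ p.1) (ξ p.1) p.2) (V ×ˢ univ) :=
  (hγ.dotProduct_deriv hξ).contDiffOn_invD hγ.isOpen

theorem IsFieldFamily.formDensity (hγ : IsFieldFamily U V γ) (hU : IsOpen U)
    (hH : ∀ i, ContDiffOn ℝ ∞ (H i) U) (hξ : IsTestFamily V ξ) (hζ : IsTestFamily V ζ) :
    IsTestFamily V fun s => formDensity η K H (γ s) (ξ s) (ζ s) := by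
  have hξ' := hξ.derivX hγ.isOpen
  have hζ' := hζ.derivX hγ.isOpen
  -- Every term contains `ξ` or `ξ_x`, so the support is controlled by `ξ` alone even though the
  -- potential of `ζ` does not decay.
  refine (hξ.prodMk hξ').of_eq_zero hγ.isOpen ?_ fun s _ x hx => ?_
  · have hJ := hγ.contDiffOn_jac hU hH
    exact ((contDiffOn_dotProduct hξ.smooth
        (contDiffOn_mulVec hJ (contDiffOn_const_mulVec η hζ'.smooth))).sub
      (contDiffOn_dotProduct hζ.smooth
        (contDiffOn_mulVec hJ (contDiffOn_const_mulVec η hξ'.smooth)))).add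
      (contDiffOn_const.mul ((contDiffOn_dotProduct hγ.smooth hξ'.smooth).mul
        (hγ.contDiffOn_potential hζ)))
  · obtain ⟨h1, h2⟩ := Prod.mk.inj hx
    simp [Hydro.formDensity, h1, h2]

theorem IsFieldFamily.formGrad (hγ : IsFieldFamily U V γ) (hU : IsOpen U)
    (hH : ∀ i, ContDiffOn ℝ ∞ (H i) U) (hξ : IsTestFamily V ξ) (hζ : IsTestFamily V ζ) :
    IsTestFamily V fun s => formGrad η K H (γ s) (ξ s) (ζ s) := by
  have hξ' := hξ.derivX hγ.isOpen
  have hζ' := hζ.derivX hγ.isOpen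
  refine (hξ'.prodMk hζ').of_eq_zero hγ.isOpen ?_ fun s _ x hx => ?_
  · exact (((contDiffOn_mulVec (hγ.contDiffOn_hessSum hU hH hξ)
        (contDiffOn_const_mulVec η hζ'.smooth)).sub
      (contDiffOn_mulVec (hγ.contDiffOn_hessSum hU hH hζ)
        (contDiffOn_const_mulVec η hξ'.smooth))).add
      ((contDiffOn_const.mul (hγ.contDiffOn_potential hζ)).smul hξ'.smooth)).sub
      ((contDiffOn_const.mul (hγ.contDiffOn_potential hξ)).smul hζ'.smooth)
  · obtain ⟨h1, h2⟩ := Prod.mk.inj hx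
    simp [Hydro.formGrad, h1, h2]

/-- The derivatives of a family of fields have locally uniformly bounded support. -/
theorem IsFieldFamily.derivX (hγ : IsFieldFamily U V γ) :
    IsTestFamily V fun s x => deriv (γ s) x := by
  refine ⟨contDiffOn_deriv_snd hγ.isOpen hγ.smooth, fun s₀ hs₀ => ?_⟩
  obtain ⟨R, hR⟩ := hγ.locally_fixed s₀ hs₀
  obtain ⟨R', hR'⟩ := exists_bound_of_hasCompactSupport (hγ.isField s₀ hs₀).2.2
  refine ⟨max R R', hR.mono fun s hs x hx => ?_⟩
  have : γ s =ᶠ[𝓝 x] γ s₀ := by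
    filter_upwards [(isOpen_lt continuous_const continuous_abs).mem_nhds
      (lt_of_le_of_lt (le_max_left _ _) hx)] with y hy
    exact hs y hy
  rw [this.deriv_eq]
  exact hR' x (lt_of_le_of_lt (le_max_right _ _) hx)

/-- Each term carries `u_x` or `ζ_x`, so the flow is compactly supported despite the nonlocal
potential. It is thus an admissible variation, along which functionals can be differentiated again.
-/
theorem IsFieldFamily.flow (hγ : IsFieldFamily U V γ) (hU : IsOpen U)
    (hH : ∀ i, ContDiffOn ℝ ∞ (H i) U) (hζ : IsTestFamily V ζ) :
    IsTestFamily V fun s => flow η K H (γ s) (ζ s) := by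
  have hγ' := hγ.derivX
  have hζ' := hζ.derivX hγ.isOpen
  refine (hγ'.prodMk hζ').of_eq_zero hγ.isOpen ?_ fun s _ x hx => ?_
  · have hG : ∀ i j, ContDiffOn ℝ ∞
        (fun p : P × ℝ => Matrix.of (canonicalMetric η K H (γ p.1 p.2)) i j) (V ×ˢ univ) :=
      fun i j => hγ.contDiffOn_comp (contDiffOn_canonicalMetric hU hH i j)
    exact ((contDiffOn_mulVec hG hζ'.smooth).add
      (contDiffOn_const_mulVec η
        (contDiffOn_mulVec (hγ.contDiffOn_hessSum hU hH hζ) hγ'.smooth))).sub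
      ((contDiffOn_const.mul (hγ.contDiffOn_potential hζ)).smul hγ'.smooth)
  · obtain ⟨h1, h2⟩ := Prod.mk.inj hx
    simp [Hydro.flow, h1, h2]

end Families

/-! ### Identities at a single field -/

section Fields

variable {u ξ ζ : ℝ → Fin N → ℝ} {η : Matrix (Fin N) (Fin N) ℝ} {K : ℝ}
  {H : Fin N → (Fin N → ℝ) → ℝ}

theorem IsField.isTest_formGrad (hu : IsField U u) (hU : IsOpen U)
    (hH : ∀ i, ContDiffOn ℝ ∞ (H i) U) (hξ : IsTest ξ) (hζ : IsTest ζ) :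
    IsTest (formGrad η K H u ξ ζ) :=
  ((IsFieldFamily.const (P := ℝ) hu).formGrad hU hH (hξ.testFamily univ)
    (hζ.testFamily univ)).isTest (mem_univ 0)

theorem IsField.isTest_flow (hu : IsField U u) (hU : IsOpen U)
    (hH : ∀ i, ContDiffOn ℝ ∞ (H i) U) (hζ : IsTest ζ) : IsTest (flow η K H u ζ) :=
  ((IsFieldFamily.const (P := ℝ) hu).flow hU hH (hζ.testFamily univ)).isTest (mem_univ 0)

theorem IsField.integrable_formDensity (hu : IsField U u) (hU : IsOpen U)
    (hH : ∀ i, ContDiffOn ℝ ∞ (H i) U) (hξ : IsTest ξ) (hζ : IsTest ζ) :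
    Integrable (formDensity η K H u ξ ζ) :=
  ((IsFieldFamily.const (P := ℝ) hu).formDensity hU hH (hξ.testFamily univ)
    (hζ.testFamily univ)).integrable (mem_univ 0)

theorem IsTest.isTest_deriv (hξ : IsTest ξ) : IsTest (deriv ξ) :=
  ((hξ.testFamily (univ : Set ℝ)).derivX isOpen_univ).isTest (mem_univ 0)

theorem IsTest.continuous (hξ : IsTest ξ) : Continuous ξ := hξ.1.continuous

/-- Pairing a continuous function with a test function. -/
theorem IsTest.dotProduct_left (hξ : IsTest ξ) {v : ℝ → Fin N → ℝ} (hv : Continuous v) :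
    Continuous (fun x => v x ⬝ᵥ ξ x) ∧ HasCompactSupport fun x => v x ⬝ᵥ ξ x := by
  refine ⟨hv.dotProduct hξ.continuous, ?_⟩
  obtain ⟨R, hR⟩ := exists_bound_of_hasCompactSupport hξ.2
  exact hasCompactSupport_of_bound (R := R) fun x hx => by simp [hR x hx]

theorem IsTest.integrable_dotProduct_left (hξ : IsTest ξ) {v : ℝ → Fin N → ℝ}
    (hv : Continuous v) : Integrable fun x => v x ⬝ᵥ ξ x :=
  (hξ.dotProduct_left hv).1.integrable_of_hasCompactSupport (hξ.dotProduct_left hv).2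

theorem IsField.hasDerivAt_potential (hu : IsField U u) (hξ : IsTest ξ) (x : ℝ) :
    HasDerivAt (potential u ξ) (u x ⬝ᵥ deriv ξ x) x :=
  hasDerivAt_invD (hξ.isTest_deriv.dotProduct_left hu.1.continuous).1
    (hξ.isTest_deriv.integrable_dotProduct_left hu.1.continuous) x

theorem IsField.continuous_potential (hu : IsField U u) (hξ : IsTest ξ) :
    Continuous (potential u ξ) :=
  continuous_iff_continuousAt.2 fun x => (hu.hasDerivAt_potential hξ x).continuousAt

theorem invD_add {f g : ℝ → ℝ} (hf : Integrable f) (hg : Integrable g) (x : ℝ) :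
    invD (fun y => f y + g y) x = invD f x + invD g x := by
  rw [invD, invD, invD, integral_add hf.integrableOn hg.integrableOn,
    integral_add hf.integrableOn hg.integrableOn]
  ring

/-- Integration by parts for `(d/dx)⁻¹`. -/
theorem IsField.invD_deriv_dotProduct (hu : IsField U u) (hξ : IsTest ξ) (x : ℝ) :
    invD (fun y => deriv u y ⬝ᵥ ξ y) x = u x ⬝ᵥ ξ x - potential u ξ x := by
  have hd : ∀ y, HasDerivAt (fun y => u y ⬝ᵥ ξ y) (deriv u y ⬝ᵥ ξ y + u y ⬝ᵥ deriv ξ y) y :=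
    fun y => hasDerivAt_dotProduct (hu.hasDerivAt y) (hξ.hasDerivAt y)
  have hu' : Continuous (deriv u) := hu.1.continuous_deriv (by simp)
  have h1 : ContDiff ℝ 1 fun y => u y ⬝ᵥ ξ y := by
    have := contDiffOn_dotProduct hu.1.contDiffOn hξ.1.contDiffOn (s := univ)
    exact (contDiffOn_univ.1 this).of_le (by simp)
  have h2 := invD_deriv h1 (hξ.dotProduct_left hu.1.continuous).2 x
  have h3 : deriv (fun y => u y ⬝ᵥ ξ y) = fun y => deriv u y ⬝ᵥ ξ y + u y ⬝ᵥ deriv ξ y :=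
    funext fun y => (hd y).deriv
  rw [h3, invD_add (hξ.integrable_dotProduct_left hu')
    (hξ.isTest_deriv.integrable_dotProduct_left hu.1.continuous)] at h2
  rw [potential]
  linarith

theorem canonicalMetric_eq (hη : η.IsSymm) (v : Fin N → ℝ) :
    Matrix.of (canonicalMetric η K H v) =
      η * (jac H v)ᵀ + jac H v * η - K • vecMulVec v v := by
  ext i j
  simp only [of_apply, canonicalMetric, Matrix.sub_apply, Matrix.add_apply, mul_apply, transpose_apply, jac,
    Matrix.smul_apply, vecMulVec_apply, smul_eq_mul, mul_assoc]
  congr 2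
  refine Finset.sum_congr rfl fun s _ => ?_
  rw [hη.apply, mul_comm]

theorem canonicalMetric_mulVec (hη : η.IsSymm) (v w : Fin N → ℝ) :
    Matrix.of (canonicalMetric η K H v) *ᵥ w =
      η *ᵥ ((jac H v)ᵀ *ᵥ w) + jac H v *ᵥ (η *ᵥ w) - (K * (v ⬝ᵥ w)) • v := by
  rw [canonicalMetric_eq hη, sub_mulVec, add_mulVec, mulVec_mulVec, mulVec_mulVec, smul_mulVec,
    vecMulVec_mulVec, mul_smul, op_smul_eq_smul]

/-- Integrating by parts inside `(d/dx)⁻¹` produces the local term `K u_x (u·ζ)`, which the summand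
`-K δⁱₖ uʲ` of the connection cancels exactly. -/
theorem hydroOp_eq_flow (hu : IsField U u) (hζ : IsTest ζ) :
    hydroOp (canonicalMetric η K H) (canonicalConnection η K H) K u ζ = flow η K H u ζ := by
  funext x i
  have hdu : ∀ y j, deriv (fun z => u z j) y = deriv u y j := fun y j =>
    (hasDerivAt_pi.1 (hu.hasDerivAt y) j).deriv
  have hdζ : ∀ y j, deriv (fun z => ζ z j) y = deriv ζ y j := fun y j =>
    (hasDerivAt_pi.1 (hζ.hasDerivAt y) j).deriv
  have hinv : invD (fun y => ∑ j, deriv u y j * ζ y j) x = u x ⬝ᵥ ζ x - potential u ζ x :=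
    hu.invD_deriv_dotProduct hζ x
  have hconn : ∑ j, ∑ k, canonicalConnection η K H (u x) i j k * deriv u x k * ζ x j =
      (η *ᵥ (hessSum H (u x) (ζ x) *ᵥ deriv u x)) i - K * deriv u x i * (u x ⬝ᵥ ζ x) := by
    have h1 : ∀ j, ∑ k, canonicalConnection η K H (u x) i j k * deriv u x k * ζ x j =
        (∑ s, η i s * (∑ k, ζ x j * pd s (pd k (H j)) (u x) * deriv u x k))
          - K * deriv u x i * (u x j * ζ x j) := by
      intro j
      have h2 : ∀ k, canonicalConnection η K H (u x) i j k * deriv u x k * ζ x j =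
          (∑ s, η i s * (ζ x j * pd s (pd k (H j)) (u x) * deriv u x k))
            - (if i = k then K * deriv u x k * (u x j * ζ x j) else 0) := by
        intro k
        rw [canonicalConnection, sub_mul, sub_mul, Finset.sum_mul, Finset.sum_mul]
        congr 1
        · exact Finset.sum_congr rfl fun s _ => by ring
        · split_ifs <;> ring
      simp_rw [h2, Finset.sum_sub_distrib, Finset.mul_sum]
      rw [Finset.sum_comm, Finset.sum_ite_eq]
      simp
    simp_rw [h1, Finset.sum_sub_distrib]
    congr 1
    · rw [Finset.sum_comm]
      simp only [mulVec, dotProduct, hessSum_apply]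
      refine Finset.sum_congr rfl fun s _ => ?_
      rw [← Finset.mul_sum, Finset.sum_comm]
      congr 1
      exact Finset.sum_congr rfl fun k _ => by rw [Finset.sum_mul]
    · rw [← Finset.mul_sum]
      rfl
  simp only [hydroOp, hdu, hdζ]
  rw [hinv, hconn]
  simp only [flow, Pi.add_apply, Pi.sub_apply, Pi.smul_apply, smul_eq_mul]
  have : (Matrix.of (canonicalMetric η K H (u x)) *ᵥ deriv ζ x) i =
    ∑ j, canonicalMetric η K H (u x) i j * deriv ζ x j := rfl
  rw [this]
  ring

/-- The bracket density and `formDensity` differ by a total derivative. -/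
theorem IsField.integral_dotProduct_flow (hu : IsField U u) (hU : IsOpen U) (hη : η.IsSymm)
    (hH : ∀ i, ContDiffOn ℝ ∞ (H i) U) (hξ : IsTest ξ) (hζ : IsTest ζ) :
    ∫ x, ξ x ⬝ᵥ flow η K H u ζ x = ∫ x, formDensity η K H u ξ ζ x := by
  have i1 : Integrable fun x => ξ x ⬝ᵥ flow η K H u ζ x :=
    hξ.integrable_dotProduct (hu.isTest_flow hU hH hζ).continuous
  have i2 : Integrable (formDensity η K H u ξ ζ) := hu.integrable_formDensity hU hH hξ hζ
  rw [← sub_eq_zero, ← integral_sub i1 i2]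
  -- The first part of this primitive trades the terms with `E(ζ)u_x` and the transposed Jacobian
  -- for derivatives of `ξ`. The second moves the derivative off `u` in `-K p(ζ) u_x·ξ` and absorbs
  -- the summand `-K uⁱuʲ` of the metric.
  have hd : ∀ x, HasDerivAt
      (fun x => ζ x ⬝ᵥ (jac H (u x) *ᵥ (η *ᵥ ξ x)) - K * ((u x ⬝ᵥ ξ x) * potential u ζ x))
      (ξ x ⬝ᵥ flow η K H u ζ x - formDensity η K H u ξ ζ x) x := by
    intro x
    have h1 := hasDerivAt_dotProduct_jac hU hH (hζ.hasDerivAt x) (hu.hasDerivAt x)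
      (hasDerivAt_const_mulVec η (hξ.hasDerivAt x)) (hu.2.1 x)
    have h2 := ((hasDerivAt_dotProduct (hu.hasDerivAt x) (hξ.hasDerivAt x)).mul
      (hu.hasDerivAt_potential hζ x)).const_mul K
    refine (h1.sub h2).congr_deriv ?_
    have e1 : ξ x ⬝ᵥ (η *ᵥ ((jac H (u x))ᵀ *ᵥ deriv ζ x)) =
        deriv ζ x ⬝ᵥ (jac H (u x) *ᵥ (η *ᵥ ξ x)) := by
      rw [dotProduct_mulVec, ← mulVec_transpose, hη.eq, mulVec_transpose, dotProduct_comm,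
        ← dotProduct_mulVec]
    have e2 : ξ x ⬝ᵥ (η *ᵥ (hessSum H (u x) (ζ x) *ᵥ deriv u x)) =
        deriv u x ⬝ᵥ (hessSum H (u x) (ζ x) *ᵥ (η *ᵥ ξ x)) := by
      rw [dotProduct_mulVec, ← mulVec_transpose, hη.eq, dotProduct_mulVec, ← mulVec_transpose,
        transpose_hessSum hU hH (hu.2.1 x), dotProduct_comm]
    rw [flow, formDensity, dotProduct_sub, dotProduct_add, canonicalMetric_mulVec hη,
      dotProduct_sub, dotProduct_add, e1, e2, dotProduct_smul, dotProduct_smul,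
      dotProduct_comm (ξ x) (u x), dotProduct_comm (ξ x) (deriv u x)]
    simp only [smul_eq_mul]
    ring
  refine integral_eq_zero_of_hasDerivAt_of_integrable hd (i1.sub i2) ?_
  refine Continuous.integrable_of_hasCompactSupport
    (continuous_iff_continuousAt.2 fun x => (hd x).continuousAt) ?_
  obtain ⟨R, hR⟩ := exists_bound_of_hasCompactSupport hξ.2
  exact hasCompactSupport_of_bound (R := R) fun x hx => by simp [hR x hx]

/-- The local terms are antisymmetric pointwise; the nonlocal one is so after integration, because
`(d/dx)⁻¹` is skew. -/
theorem IsField.integral_formDensity_skew (hu : IsField U u) (hU : IsOpen U)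
    (hH : ∀ i, ContDiffOn ℝ ∞ (H i) U) (hξ : IsTest ξ) (hζ : IsTest ζ) :
    ∫ x, formDensity η K H u ξ ζ x = -∫ x, formDensity η K H u ζ ξ x := by
  have i1 : Integrable (formDensity η K H u ξ ζ) := hu.integrable_formDensity hU hH hξ hζ
  have i2 : Integrable (formDensity η K H u ζ ξ) := hu.integrable_formDensity hU hH hζ hξ
  have hp := hξ.isTest_deriv.dotProduct_left hu.1.continuous
  have hq := hζ.isTest_deriv.dotProduct_left hu.1.continuous
  have hs := integral_mul_invD hp.1 hq.1 hp.2 hq.2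
  rw [eq_neg_iff_add_eq_zero, ← integral_add i1 i2]
  have : ∀ x, formDensity η K H u ξ ζ x + formDensity η K H u ζ ξ x =
      K * ((u x ⬝ᵥ deriv ξ x) * potential u ζ x + (u x ⬝ᵥ deriv ζ x) * potential u ξ x) := by
    intro x
    simp only [formDensity]
    ring
  simp_rw [this]
  rw [integral_const_mul, integral_add]
  · rw [potential, potential, hs]
    ring
  · exact (hp.1.mul (hu.continuous_potential hζ)).integrable_of_hasCompactSupport hp.2.mul_right
  · exact (hq.1.mul (hu.continuous_potential hξ)).integrable_of_hasCompactSupport hq.2.mul_right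

end Fields

/-- The derivative of the bracket form along a line of fields and smooth families of covectors. -/
theorem hasDerivAt_integral_formDensity {u h ξ' ζ' : ℝ → Fin N → ℝ} {ξ ζ : ℝ → ℝ → Fin N → ℝ}
    {η : Matrix (Fin N) (Fin N) ℝ} {K : ℝ} {H : Fin N → (Fin N → ℝ) → ℝ} (hU : IsOpen U)
    (hH : ∀ i, ContDiffOn ℝ ∞ (H i) U) (hu : IsField U u) (hh : IsTest h)
    (hξ : IsTestFamily (lineDomain U u h) ξ) (hζ : IsTestFamily (lineDomain U u h) ζ)
    (hξ' : IsTest ξ') (hζ' : IsTest ζ') (dξ : ∀ x, deriv (fun t => ξ t x) 0 = ξ' x)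
    (dζ : ∀ x, deriv (fun t => ζ t x) 0 = ζ' x) :
    HasDerivAt (fun t : ℝ => ∫ x, formDensity η K H (u + t • h) (ξ t) (ζ t) x)
      ((∫ x, formDensity η K H u ξ' (ζ 0) x) + (∫ x, formDensity η K H u (ξ 0) ζ' x)
        + ∫ x, formGrad η K H u (ξ 0) (ζ 0) x ⬝ᵥ h x) 0 := by
  have hl := hu.line hU hh
  have h0 := hu.zero_mem_lineDomain h
  have hξ0 := hξ.isTest h0
  have hζ0 := hζ.isTest h0
  have hdens : IsTestFamily (lineDomain U u h)
      fun t => formDensity η K H (u + t • h) (ξ t) (ζ t) := hl.formDensity hU hH hξ hζ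
  -- Differentiation in `t` commutes with differentiation in `x`.
  have mixed : ∀ {χ : ℝ → ℝ → Fin N → ℝ} {χ' : ℝ → Fin N → ℝ},
      IsTestFamily (lineDomain U u h) χ → (∀ x, deriv (fun t => χ t x) 0 = χ' x) →
      ∀ x, HasDerivAt (fun t => deriv (χ t) x) (deriv χ' x) 0 := by
    intro χ χ' hχ dχ x
    have h1 := (hχ.derivX hl.isOpen).hasDerivAt hl.isOpen h0 x
    have h2 := deriv_deriv_comm (f := χ) (a := 0) (b := x)
      ((hχ.smooth.contDiffAt (prod_univ_mem_nhds (p := ((0 : ℝ), x)) hl.isOpen h0)).of_le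
        (WithTop.coe_le_coe.2 (le_top : (2 : ℕ∞) ≤ ⊤)))
    have h3 : (fun x => deriv (fun t => χ t x) 0) = χ' := funext dχ
    rw [h3] at h2
    rw [← h2]
    exact h1
  have dline : ∀ x, HasDerivAt (fun t : ℝ => (u + t • h) x) (h x) 0 := by
    intro x
    have := ((hasDerivAt_id (0 : ℝ)).smul_const (h x)).const_add (u x)
    simpa using this
  have uline : ∀ x, (u + (0 : ℝ) • h) x = u x := fun x => by simp
  have u0 : u + (0 : ℝ) • h = u := by simp
  have hpd : ∀ {a : ℝ → Fin N → ℝ} {b : ℝ → Fin N → ℝ}, Continuous a → IsTest b →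
      Continuous (fun x => a x ⬝ᵥ deriv b x) ∧ HasCompactSupport fun x => a x ⬝ᵥ deriv b x :=
    fun ha hb => hb.isTest_deriv.dotProduct_left ha
  have hpi : ∀ {a : ℝ → Fin N → ℝ} {b : ℝ → Fin N → ℝ}, Continuous a → IsTest b →
      Integrable fun x => a x ⬝ᵥ deriv b x :=
    fun ha hb => hb.isTest_deriv.integrable_dotProduct_left ha
  have dpair : ∀ {χ : ℝ → ℝ → Fin N → ℝ} {χ' : ℝ → Fin N → ℝ},
      IsTestFamily (lineDomain U u h) χ → (∀ x, deriv (fun t => χ t x) 0 = χ' x) →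
      ∀ x, HasDerivAt (fun t : ℝ => (u + t • h) x ⬝ᵥ deriv (χ t) x)
        (h x ⬝ᵥ deriv (χ 0) x + u x ⬝ᵥ deriv χ' x) 0 := by
    intro χ χ' hχ dχ x
    have := hasDerivAt_dotProduct (dline x) (mixed hχ dχ x)
    rwa [uline] at this
  -- This is the part of the variation of the potential of `ζ` that comes from moving the field.
  set q : ℝ → ℝ := invD fun y => h y ⬝ᵥ deriv (ζ 0) y with hq
  have dpot : ∀ x, HasDerivAt (fun t : ℝ => potential (u + t • h) (ζ t) x)
      (q x + potential u ζ' x) 0 := by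
    intro x
    have hfam := hl.dotProduct_deriv hζ
    have e : (fun y => deriv (fun t : ℝ => (u + t • h) y ⬝ᵥ deriv (ζ t) y) 0) =
        fun y => h y ⬝ᵥ deriv (ζ 0) y + u y ⬝ᵥ deriv ζ' y :=
      funext fun y => (dpair hζ dζ y).deriv
    have h1 := hfam.hasDerivAt_invD hl.isOpen h0 x (by
      rw [e]
      exact (hpi hh.continuous hζ0).add (hpi hu.1.continuous hζ'))
    rw [e, invD_add (hpi hh.continuous hζ0) (hpi hu.1.continuous hζ')] at h1
    exact h1
  -- The expected density appears pointwise only up to the last summand: `formGrad` has the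
  -- variation `h` outside the potential, while `q` has it inside. That summand integrates to zero
  -- by the skewness of `(d/dx)⁻¹`.
  have dd : ∀ x, deriv (fun t : ℝ => formDensity η K H (u + t • h) (ξ t) (ζ t) x) 0 =
      (formDensity η K H u ξ' (ζ 0) x + formDensity η K H u (ξ 0) ζ' x
        + formGrad η K H u (ξ 0) (ζ 0) x ⬝ᵥ h x)
      + K * ((u x ⬝ᵥ deriv (ξ 0) x) * q x + (h x ⬝ᵥ deriv (ζ 0) x) * potential u (ξ 0) x) := by
    intro x
    have aξ := hξ.hasDerivAt hl.isOpen h0 x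
    have aζ := hζ.hasDerivAt hl.isOpen h0 x
    rw [dξ] at aξ
    rw [dζ] at aζ
    have hmem : (u + (0 : ℝ) • h) x ∈ U := by
      rw [uline]
      exact hu.2.1 x
    have t1 := hasDerivAt_dotProduct_jac hU hH aξ (dline x)
      (hasDerivAt_const_mulVec η (mixed hζ dζ x)) hmem
    have t2 := hasDerivAt_dotProduct_jac hU hH aζ (dline x)
      (hasDerivAt_const_mulVec η (mixed hξ dξ x)) hmem
    have t3 := ((dpair hξ dξ x).mul (dpot x)).const_mul K
    rw [uline] at t1 t2
    refine (((t1.sub t2).add t3).deriv).trans ?_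
    rw [u0, formGrad, sub_dotProduct, add_dotProduct, sub_dotProduct, smul_dotProduct,
      smul_dotProduct, dotProduct_comm _ (h x), dotProduct_comm _ (h x), dotProduct_comm _ (h x),
      dotProduct_comm _ (h x), formDensity, formDensity]
    simp only [smul_eq_mul]
    ring
  refine (hdens.hasDerivAt_integral hl.isOpen h0).congr_deriv ?_
  simp_rw [dd]
  have i1 : Integrable (formDensity η K H u ξ' (ζ 0)) := hu.integrable_formDensity hU hH hξ' hζ0
  have i2 : Integrable (formDensity η K H u (ξ 0) ζ') := hu.integrable_formDensity hU hH hξ0 hζ'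
  have i3 : Integrable fun x => formGrad η K H u (ξ 0) (ζ 0) x ⬝ᵥ h x :=
    hh.integrable_dotProduct_left (hu.isTest_formGrad hU hH hξ0 hζ0).continuous
  have pu := hpd hu.1.continuous hξ0
  have ph := hpd hh.continuous hζ0
  have hqc : Continuous q := continuous_iff_continuousAt.2 fun x =>
    (hasDerivAt_invD ph.1 (hpi hh.continuous hζ0) x).continuousAt
  have i4 : Integrable fun x => (u x ⬝ᵥ deriv (ξ 0) x) * q x :=
    (pu.1.mul hqc).integrable_of_hasCompactSupport pu.2.mul_right
  have i5 : Integrable fun x => (h x ⬝ᵥ deriv (ζ 0) x) * potential u (ξ 0) x :=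
    (ph.1.mul (hu.continuous_potential hξ0)).integrable_of_hasCompactSupport ph.2.mul_right
  have hskew := integral_mul_invD pu.1 ph.1 pu.2 ph.2
  have i12 : Integrable fun x => formDensity η K H u ξ' (ζ 0) x + formDensity η K H u (ξ 0) ζ' x :=
    i1.add i2
  have i45 : Integrable fun x => (u x ⬝ᵥ deriv (ξ 0) x) * q x
      + (h x ⬝ᵥ deriv (ζ 0) x) * potential u (ξ 0) x := i4.add i5
  have i123 : Integrable fun x => formDensity η K H u ξ' (ζ 0) x + formDensity η K H u (ξ 0) ζ' x
      + formGrad η K H u (ξ 0) (ζ 0) x ⬝ᵥ h x := i12.add i3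
  rw [integral_add i123 (i45.const_mul K), integral_add i12 i3,
    integral_add i1 i2, integral_const_mul, integral_add i4 i5, hq, hskew, potential]
  ring

end Operator

/-! ### The bracket as a smooth functional, and the Jacobi sum -/

section Bracket

variable {N : ℕ} {U : Set (Fin N → ℝ)} {η : Matrix (Fin N) (Fin N) ℝ} {K : ℝ}
  {H : Fin N → (Fin N → ℝ) → ℝ} {I J L : (ℝ → Fin N → ℝ) → ℝ} {u : ℝ → Fin N → ℝ}

theorem bracket_eq_integral_flow (hI : IsFunctional U I) (hu : IsField U u)
    (F : (ℝ → Fin N → ℝ) → ℝ) :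
    bracket (canonicalMetric η K H) (canonicalConnection η K H) K F I u =
      ∫ x, varDeriv F u x ⬝ᵥ flow η K H u (varDeriv I u) x := by
  rw [bracket, hydroOp_eq_flow hu (hI.isTest hu)]
  rfl

theorem bracket_eq_integral_formDensity (hU : IsOpen U) (hη : η.IsSymm)
    (hH : ∀ i, ContDiffOn ℝ ∞ (H i) U) (hI : IsFunctional U I) (hJ : IsFunctional U J)
    (hu : IsField U u) :
    bracket (canonicalMetric η K H) (canonicalConnection η K H) K I J u =
      ∫ x, formDensity η K H u (varDeriv I u) (varDeriv J u) x := by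
  rw [bracket_eq_integral_flow hJ hu,
    hu.integral_dotProduct_flow hU hη hH (hI.isTest hu) (hJ.isTest hu)]

/-- The variational derivative of the bracket of `I` and `J`. -/
def bracketVar (η : Matrix (Fin N) (Fin N) ℝ) (K : ℝ) (H : Fin N → (Fin N → ℝ) → ℝ)
    (I J : (ℝ → Fin N → ℝ) → ℝ) (u : ℝ → Fin N → ℝ) (x : ℝ) : Fin N → ℝ :=
  secondVar I u (flow η K H u (varDeriv J u)) x - secondVar J u (flow η K H u (varDeriv I u)) x
    + formGrad η K H u (varDeriv I u) (varDeriv J u) x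

theorem integral_bracketVar (hU : IsOpen U) (hH : ∀ i, ContDiffOn ℝ ∞ (H i) U)
    (hI : IsFunctional U I) (hJ : IsFunctional U J) (hu : IsField U u) {h : ℝ → Fin N → ℝ}
    (hh : IsTest h) :
    ∫ x, bracketVar η K H I J u x ⬝ᵥ h x =
      (∫ x, secondVar I u (flow η K H u (varDeriv J u)) x ⬝ᵥ h x)
        - (∫ x, secondVar J u (flow η K H u (varDeriv I u)) x ⬝ᵥ h x)
        + ∫ x, formGrad η K H u (varDeriv I u) (varDeriv J u) x ⬝ᵥ h x := by
  have hξ := hI.isTest hu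
  have hζ := hJ.isTest hu
  have i1 := hh.integrable_dotProduct_left
    (hI.secondVar_isTest hU hu (hu.isTest_flow (η := η) (K := K) hU hH hζ)).continuous
  have i2 := hh.integrable_dotProduct_left
    (hJ.secondVar_isTest hU hu (hu.isTest_flow (η := η) (K := K) hU hH hξ)).continuous
  have i3 := hh.integrable_dotProduct_left
    (hu.isTest_formGrad (η := η) (K := K) hU hH hξ hζ).continuous
  have : ∀ x, bracketVar η K H I J u x ⬝ᵥ h x =
      secondVar I u (flow η K H u (varDeriv J u)) x ⬝ᵥ h x
        - secondVar J u (flow η K H u (varDeriv I u)) x ⬝ᵥ h x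
        + formGrad η K H u (varDeriv I u) (varDeriv J u) x ⬝ᵥ h x := fun x => by
    rw [bracketVar, add_dotProduct, sub_dotProduct]
  simp_rw [this]
  have i12 : Integrable fun x => secondVar I u (flow η K H u (varDeriv J u)) x ⬝ᵥ h x
      - secondVar J u (flow η K H u (varDeriv I u)) x ⬝ᵥ h x := i1.sub i2
  rw [integral_add i12 i3, integral_sub i1 i2]

theorem IsFieldFamily.bracketVar {P : Type*} [NormedAddCommGroup P] [NormedSpace ℝ P]
    [FiniteDimensional ℝ P] {V : Set P} {γ : P → ℝ → Fin N → ℝ} (hγ : IsFieldFamily U V γ)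
    (hU : IsOpen U) (hH : ∀ i, ContDiffOn ℝ ∞ (H i) U) (hI : IsFunctional U I)
    (hJ : IsFunctional U J) : IsTestFamily V fun s => bracketVar η K H I J (γ s) := by
  have hξ := hI.testFamily hγ
  have hζ := hJ.testFamily hγ
  have h1 := hI.secondVar_testFamily hU hγ (hγ.flow (η := η) (K := K) hU hH hζ)
  have h2 := hJ.secondVar_testFamily hU hγ (hγ.flow (η := η) (K := K) hU hH hξ)
  have h3 := hγ.formGrad (η := η) (K := K) hU hH hξ hζ
  refine ((h1.prodMk h2).prodMk h3).of_eq_zero hγ.isOpen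
    ((h1.smooth.sub h2.smooth).add h3.smooth) fun s _ x hx => ?_
  obtain ⟨h12, h3⟩ := Prod.mk.inj hx
  obtain ⟨h1, h2⟩ := Prod.mk.inj h12
  rw [Hydro.bracketVar, h1, h2, h3]
  simp

/-- Along a line of fields the form varies through its two covectors and through the field. The last
contribution is `formGrad`; in the other two, `h` sits inside a second variation paired with a flow,
and symmetry of second variations turns this into a pairing with `h`. -/
theorem hasVarDeriv_bracket (hU : IsOpen U) (hη : η.IsSymm) (hH : ∀ i, ContDiffOn ℝ ∞ (H i) U)
    (hI : IsFunctional U I) (hJ : IsFunctional U J) (hu : IsField U u) :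
    HasVarDeriv (bracket (canonicalMetric η K H) (canonicalConnection η K H) K I J) u
      (bracketVar η K H I J u) := by
  refine ⟨((IsFieldFamily.const (P := ℝ) hu).bracketVar hU hH hI hJ).isTest (mem_univ 0),
    fun h hh => ?_⟩
  have hξ := hI.isTest hu
  have hζ := hJ.isTest hu
  have hl := hu.line hU hh
  have h0 := hu.zero_mem_lineDomain h
  have u0 : u + (0 : ℝ) • h = u := by simp
  have hI' := hI.secondVar_isTest hU hu hh
  have hJ' := hJ.secondVar_isTest hU hu hh
  have hfI := hu.isTest_flow (η := η) (K := K) hU hH hξ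
  have hfJ := hu.isTest_flow (η := η) (K := K) hU hH hζ
  have hd := hasDerivAt_integral_formDensity (η := η) (K := K) hU hH hu hh (hI.testFamily hl)
    (hJ.testFamily hl) hI' hJ' (fun _ => rfl) (fun _ => rfl)
  simp only [u0] at hd
  refine (hd.congr_deriv ?_).congr_of_eventuallyEq ?_
  · have e := integral_bracketVar (η := η) (K := K) hU hH hI hJ hu hh
    refine Eq.trans ?_ e.symm
    rw [← hu.integral_dotProduct_flow hU hη hH hI' hζ,
      hu.integral_formDensity_skew hU hH hξ hJ',
      ← hu.integral_dotProduct_flow hU hη hH hJ' hξ,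
      hI.integral_secondVar_comm hU hu hfJ hh, hJ.integral_secondVar_comm hU hu hfI hh]
    ring
  · filter_upwards [hl.isOpen.mem_nhds h0] with t ht
    exact bracket_eq_integral_formDensity hU hη hH hI hJ (hl.isField t ht)

/-- The bracket of smooth functionals is a smooth functional. -/
theorem isFunctional_bracket (hU : IsOpen U) (hη : η.IsSymm)
    (hH : ∀ i, ContDiffOn ℝ ∞ (H i) U) (hI : IsFunctional U I) (hJ : IsFunctional U J) :
    IsFunctional U (bracket (canonicalMetric η K H) (canonicalConnection η K H) K I J) := by
  have hvd : ∀ u, IsField U u →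
      varDeriv (bracket (canonicalMetric η K H) (canonicalConnection η K H) K I J) u =
        bracketVar η K H I J u :=
    fun u hu => (hasVarDeriv_bracket hU hη hH hI hJ hu).varDeriv_eq
  have hfam : ∀ {m : ℕ} {V : Set (Fin m → ℝ)} {γ : (Fin m → ℝ) → ℝ → Fin N → ℝ},
      IsSmoothFamily U V γ → IsFieldFamily U V γ := fun hγ =>
    ⟨hγ.isOpen, hγ.isField, hγ.smooth, hγ.locally_fixed⟩
  refine ⟨fun u hu => ⟨_, hasVarDeriv_bracket hU hη hH hI hJ hu⟩, ?_, ?_, ?_⟩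
  · intro m V γ hγ
    have hγ := hfam hγ
    refine ((hγ.formDensity (η := η) (K := K) hU hH (hI.testFamily hγ)
      (hJ.testFamily hγ)).contDiffOn_integral hγ.isOpen).congr fun s hs => ?_
    exact bracket_eq_integral_formDensity hU hη hH hI hJ (hγ.isField s hs)
  · intro m V γ hγ
    have hγ := hfam hγ
    refine (hγ.bracketVar (η := η) (K := K) hU hH hI hJ).smooth.congr fun p hp => ?_
    rw [hvd _ (hγ.isField _ hp.1)]
  · intro m V γ hγ s₀ hs₀
    have hγ := hfam hγ
    obtain ⟨R, hR⟩ := (hγ.bracketVar (η := η) (K := K) hU hH hI hJ).support s₀ hs₀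
    refine ⟨R, ?_⟩
    filter_upwards [hR, hγ.isOpen.mem_nhds hs₀] with s hs hsV x hx
    rw [hvd _ (hγ.isField _ hsV), hs x hx]

theorem bracket_skew (hU : IsOpen U) (hη : η.IsSymm) (hH : ∀ i, ContDiffOn ℝ ∞ (H i) U)
    (hI : IsFunctional U I) (hJ : IsFunctional U J) (hu : IsField U u) :
    bracket (canonicalMetric η K H) (canonicalConnection η K H) K I J u =
      -bracket (canonicalMetric η K H) (canonicalConnection η K H) K J I u := by
  rw [bracket_eq_integral_formDensity hU hη hH hI hJ hu,
    bracket_eq_integral_formDensity hU hη hH hJ hI hu,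
    hu.integral_formDensity_skew hU hH (hI.isTest hu) (hJ.isTest hu)]

/-- The obstruction to the Jacobi identity, as a density depending on three covectors. -/
def jacobiDensity (η : Matrix (Fin N) (Fin N) ℝ) (K : ℝ) (H : Fin N → (Fin N → ℝ) → ℝ)
    (u ξ ζ χ : ℝ → Fin N → ℝ) (x : ℝ) : ℝ :=
  formGrad η K H u ξ ζ x ⬝ᵥ flow η K H u χ x + formGrad η K H u ζ χ x ⬝ᵥ flow η K H u ξ x
    + formGrad η K H u χ ξ x ⬝ᵥ flow η K H u ζ x

/-- In the Jacobi sum the second variations cancel. -/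
theorem jacobi_sum_eq (hU : IsOpen U) (hη : η.IsSymm) (hH : ∀ i, ContDiffOn ℝ ∞ (H i) U)
    (hI : IsFunctional U I) (hJ : IsFunctional U J) (hL : IsFunctional U L) (hu : IsField U u) :
    bracket (canonicalMetric η K H) (canonicalConnection η K H) K
        (bracket (canonicalMetric η K H) (canonicalConnection η K H) K I J) L u
      + bracket (canonicalMetric η K H) (canonicalConnection η K H) K
        (bracket (canonicalMetric η K H) (canonicalConnection η K H) K J L) I u
      + bracket (canonicalMetric η K H) (canonicalConnection η K H) K
        (bracket (canonicalMetric η K H) (canonicalConnection η K H) K L I) J u =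
      ∫ x, jacobiDensity η K H u (varDeriv I u) (varDeriv J u) (varDeriv L u) x := by
  have key : ∀ {A B C : (ℝ → Fin N → ℝ) → ℝ}, IsFunctional U A → IsFunctional U B →
      IsFunctional U C →
      bracket (canonicalMetric η K H) (canonicalConnection η K H) K
        (bracket (canonicalMetric η K H) (canonicalConnection η K H) K A B) C u =
      (∫ x, secondVar A u (flow η K H u (varDeriv B u)) x ⬝ᵥ flow η K H u (varDeriv C u) x)
        - (∫ x, secondVar B u (flow η K H u (varDeriv A u)) x ⬝ᵥ flow η K H u (varDeriv C u) x)
        + ∫ x, formGrad η K H u (varDeriv A u) (varDeriv B u) x ⬝ᵥ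
            flow η K H u (varDeriv C u) x := by
    intro A B C hA hB hC
    rw [bracket_eq_integral_flow hC hu, (hasVarDeriv_bracket hU hη hH hA hB hu).varDeriv_eq]
    exact integral_bracketVar hU hH hA hB hu (hu.isTest_flow hU hH (hC.isTest hu))
  have fI := hu.isTest_flow (η := η) (K := K) hU hH (hI.isTest hu)
  have fJ := hu.isTest_flow (η := η) (K := K) hU hH (hJ.isTest hu)
  have fL := hu.isTest_flow (η := η) (K := K) hU hH (hL.isTest hu)
  -- Each functional's second variation occurs twice with opposite signs, evaluated on the flows of
  -- the other two in both orders; one symmetry per functional makes the pairs identical.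
  rw [key hI hJ hL, key hJ hL hI, key hL hI hJ, hI.integral_secondVar_comm hU hu fL fJ,
    hJ.integral_secondVar_comm hU hu fL fI, hL.integral_secondVar_comm hU hu fJ fI]
  have gi : ∀ {a b c : ℝ → Fin N → ℝ}, IsTest a → IsTest b → IsTest c →
      Integrable fun x => formGrad η K H u a b x ⬝ᵥ flow η K H u c x := fun ha hb hc =>
    (hu.isTest_formGrad hU hH ha hb).integrable_dotProduct
      (hu.isTest_flow hU hH hc).continuous
  have i1 := gi (hI.isTest hu) (hJ.isTest hu) (hL.isTest hu)
  have i2 := gi (hJ.isTest hu) (hL.isTest hu) (hI.isTest hu)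
  have i3 := gi (hL.isTest hu) (hI.isTest hu) (hJ.isTest hu)
  simp only [jacobiDensity]
  rw [integral_add (by exact i1.add i2) i3, integral_add i1 i2]
  ring

/-- Closure and skewness hold automatically. The Jacobi sum sees the functionals only through their
variational derivatives at `u`, and linear functionals make these arbitrary. -/
theorem isPoissonBracket_iff_integral_jacobiDensity (hU : IsOpen U) (hη : η.IsSymm)
    (hH : ∀ i, ContDiffOn ℝ ∞ (H i) U) :
    IsPoissonBracket U (canonicalMetric η K H) (canonicalConnection η K H) K ↔
      ∀ u ξ ζ χ : ℝ → Fin N → ℝ, IsField U u → IsTest ξ → IsTest ζ → IsTest χ →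
        ∫ x, jacobiDensity η K H u ξ ζ χ x = 0 := by
  constructor
  · intro hP u ξ ζ χ hu hξ hζ hχ
    have fξ := isFunctional_linearFunctional (U := U) hξ
    have fζ := isFunctional_linearFunctional (U := U) hζ
    have fχ := isFunctional_linearFunctional (U := U) hχ
    have h := hP.jacobi _ _ _ fξ fζ fχ u hu
    rwa [jacobi_sum_eq hU hη hH fξ fζ fχ hu, (hasVarDeriv_linearFunctional hξ hu).varDeriv_eq,
      (hasVarDeriv_linearFunctional hζ hu).varDeriv_eq,
      (hasVarDeriv_linearFunctional hχ hu).varDeriv_eq] at h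
  · intro h
    refine ⟨fun I J hI hJ => isFunctional_bracket hU hη hH hI hJ,
      fun I J hI hJ u hu => bracket_skew hU hη hH hI hJ hu, fun I J L hI hJ hL u hu => ?_⟩
    rw [jacobi_sum_eq hU hη hH hI hJ hL hu]
    exact h u _ _ _ hu (hI.isTest hu) (hJ.isTest hu) (hL.isTest hu)

end Bracket

/-! ### Pointwise algebra of the Jacobi obstruction -/

section Algebra

variable {N : ℕ} {U : Set (Fin N → ℝ)} {η : Matrix (Fin N) (Fin N) ℝ} {K : ℝ}
  {H : Fin N → (Fin N → ℝ) → ℝ} {u ξ ζ χ : ℝ → Fin N → ℝ}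

/-- The skew part of the bilinear form `η (ξ · ∂²H) g`. -/
def metricDefect (η : Matrix (Fin N) (Fin N) ℝ) (K : ℝ) (H : Fin N → (Fin N → ℝ) → ℝ)
    (v ξ b c : Fin N → ℝ) : ℝ :=
  b ⬝ᵥ (η *ᵥ (hessSum H v ξ *ᵥ (Matrix.of (canonicalMetric η K H v) *ᵥ c)))
    - c ⬝ᵥ (η *ᵥ (hessSum H v ξ *ᵥ (Matrix.of (canonicalMetric η K H v) *ᵥ b)))

/-- The commutator of `η (ξ · ∂²H)` and `η (ζ · ∂²H)`. -/
def hessDefect (η : Matrix (Fin N) (Fin N) ℝ) (H : Fin N → (Fin N → ℝ) → ℝ)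
    (v ξ ζ w b : Fin N → ℝ) : ℝ :=
  b ⬝ᵥ (η *ᵥ (hessSum H v ξ *ᵥ (η *ᵥ (hessSum H v ζ *ᵥ w))))
    - b ⬝ᵥ (η *ᵥ (hessSum H v ζ *ᵥ (η *ᵥ (hessSum H v ξ *ᵥ w))))

theorem mulVec_dotProduct_of_symm {A : Matrix (Fin N) (Fin N) ℝ} (hA : Aᵀ = A)
    (x y : Fin N → ℝ) : (A *ᵥ x) ⬝ᵥ y = x ⬝ᵥ (A *ᵥ y) := by
  rw [dotProduct_mulVec, ← mulVec_transpose, hA]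

theorem transpose_canonicalMetric (v : Fin N → ℝ) :
    (Matrix.of (canonicalMetric η K H v))ᵀ = Matrix.of (canonicalMetric η K H v) := by
  ext i j
  simp only [transpose_apply, of_apply, canonicalMetric]
  ring

/-- All nonlocal terms cancel in the obstruction to the Jacobi identity. -/
theorem jacobiDensity_eq (hU : IsOpen U) (hη : η.IsSymm) (hH : ∀ i, ContDiffOn ℝ ∞ (H i) U)
    (hu : IsField U u) (x : ℝ) :
    jacobiDensity η K H u ξ ζ χ x =
      metricDefect η K H (u x) (ξ x) (deriv ζ x) (deriv χ x)
        + metricDefect η K H (u x) (ζ x) (deriv χ x) (deriv ξ x)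
        + metricDefect η K H (u x) (χ x) (deriv ξ x) (deriv ζ x)
        + hessDefect η H (u x) (ξ x) (χ x) (deriv u x) (deriv ζ x)
        + hessDefect η H (u x) (ζ x) (ξ x) (deriv u x) (deriv χ x)
        + hessDefect η H (u x) (χ x) (ζ x) (deriv u x) (deriv ξ x) := by
  -- Terms with two potentials cancel cyclically with no further input. Terms with one potential
  -- cancel in pairs by symmetry of the metric, or of `η` and the contracted Hessians.
  have hE := fun ξ => mulVec_dotProduct_of_symm (transpose_hessSum hU hH (hu.2.1 x) ξ)
  have hη' := mulVec_dotProduct_of_symm hη.eq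
  have hG := mulVec_dotProduct_of_symm (transpose_canonicalMetric (η := η) (K := K) (H := H) (u x))
  have hG' : ∀ a b : Fin N → ℝ, a ⬝ᵥ (Matrix.of (canonicalMetric η K H (u x)) *ᵥ b) =
      b ⬝ᵥ (Matrix.of (canonicalMetric η K H (u x)) *ᵥ a) := fun a b => by
    rw [← hG, dotProduct_comm]
  simp only [jacobiDensity, formGrad, flow, metricDefect, hessDefect, add_dotProduct,
    sub_dotProduct, dotProduct_add, dotProduct_sub, smul_dotProduct, dotProduct_smul, hE, hη',
    smul_eq_mul]
  rw [hG' (deriv χ x) (deriv ξ x), hG' (deriv χ x) (deriv ζ x), hG' (deriv ζ x) (deriv ξ x)]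
  ring

theorem dotProduct_mulVec_hessSum_mulVec (A B : Matrix (Fin N) (Fin N) ℝ) (v ξ b c : Fin N → ℝ) :
    b ⬝ᵥ (A *ᵥ (hessSum H v ξ *ᵥ (B *ᵥ c))) =
      ∑ k, ξ k * (b ⬝ᵥ ((A * hess (H k) v * B) *ᵥ c)) := by
  have h : A * hessSum H v ξ * B = ∑ k, ξ k • (A * hess (H k) v * B) := by
    simp only [hessSum, Finset.sum_mul, Finset.mul_sum, Matrix.smul_mul, Matrix.mul_smul]
  rw [mulVec_mulVec, mulVec_mulVec, h]
  simp only [sum_mulVec, smul_mulVec, dotProduct_sum, dotProduct_smul, smul_eq_mul]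

theorem metricDefect_eq_zero {v : Fin N → ℝ}
    (h : ∀ k, (η * hess (H k) v * Matrix.of (canonicalMetric η K H v))ᵀ =
      η * hess (H k) v * Matrix.of (canonicalMetric η K H v)) (ξ b c : Fin N → ℝ) :
    metricDefect η K H v ξ b c = 0 := by
  rw [metricDefect, dotProduct_mulVec_hessSum_mulVec, dotProduct_mulVec_hessSum_mulVec,
    sub_eq_zero]
  refine Finset.sum_congr rfl fun k _ => ?_
  rw [← mulVec_dotProduct_of_symm (h k), dotProduct_comm]

theorem hessDefect_eq_zero {v : Fin N → ℝ}
    (h : ∀ i j, hess (H i) v * η * hess (H j) v = hess (H j) v * η * hess (H i) v)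
    (ξ ζ w b : Fin N → ℝ) : hessDefect η H v ξ ζ w b = 0 := by
  have hc : hessSum H v ξ * η * hessSum H v ζ = hessSum H v ζ * η * hessSum H v ξ := by
    simp only [hessSum, Finset.sum_mul, Finset.mul_sum, Matrix.smul_mul, Matrix.mul_smul]
    rw [Finset.sum_comm]
    refine Finset.sum_congr rfl fun i _ => Finset.sum_congr rfl fun j _ => ?_
    rw [h, smul_comm]
  have : ∀ ξ ζ, hessSum H v ξ *ᵥ (η *ᵥ (hessSum H v ζ *ᵥ w)) =
      (hessSum H v ξ * η * hessSum H v ζ) *ᵥ w := fun ξ ζ => by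
    rw [mulVec_mulVec, mulVec_mulVec, Matrix.mul_assoc]
  rw [hessDefect, this, this, hc, sub_self]

theorem hessSum_smul_single (v : Fin N → ℝ) (a : ℝ) (k : Fin N) :
    hessSum H v (a • Pi.single k 1) = a • hess (H k) v := by
  rw [hessSum, Finset.sum_eq_single k]
  · simp
  · intro j _ hj
    simp [hj]
  · simp

theorem metricDefect_smul (v ξ b c : Fin N → ℝ) (r s t : ℝ) :
    metricDefect η K H v (r • ξ) (s • b) (t • c) = (r * s * t) * metricDefect η K H v ξ b c := by
  have : hessSum H v (r • ξ) = r • hessSum H v ξ := by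
    simp [hessSum, Finset.smul_sum, smul_smul]
  simp only [metricDefect, this, smul_mulVec, mulVec_smul, smul_dotProduct, dotProduct_smul,
    smul_eq_mul]
  ring

theorem hessDefect_smul (v ξ ζ w b : Fin N → ℝ) (p q r s : ℝ) :
    hessDefect η H v (p • ξ) (q • ζ) (r • w) (s • b) =
      (p * q * r * s) * hessDefect η H v ξ ζ w b := by
  have : ∀ (r : ℝ) ξ, hessSum H v (r • ξ) = r • hessSum H v ξ := fun r ξ => by
    simp [hessSum, Finset.smul_sum, smul_smul]
  simp only [hessDefect, this, smul_mulVec, mulVec_smul, smul_dotProduct, dotProduct_smul,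
    smul_eq_mul]
  ring

end Algebra

/-! ### Necessity: isolating the defects by bump functions -/

section Necessity

/-- A bump function `β` together with a cutoff `α` equal to one on its support. -/
theorem exists_bump_cutoff : ∃ α β : ℝ → ℝ, ContDiff ℝ ∞ α ∧ ContDiff ℝ ∞ β ∧
    HasCompactSupport α ∧ HasCompactSupport β ∧ (∀ x, β x * deriv α x = 0) ∧
    (∀ x, deriv β x * deriv α x = 0) ∧ (∀ x, α x * deriv β x = deriv β x) ∧
    (∀ x, |β x| ≤ 1) ∧ ∃ x, deriv β x ≠ 0 := by
  -- The inner radius 3 of the cutoff exceeds the outer radius 2 of the bump, so the cutoff is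
  -- locally constant on the whole support of the bump.
  let b : ContDiffBump (0 : ℝ) := ⟨1, 2, one_pos, by norm_num⟩
  let a : ContDiffBump (0 : ℝ) := ⟨3, 4, by norm_num, by norm_num⟩
  have hb0 : ∀ x : ℝ, 2 < |x| → b x = 0 := fun x hx => b.zero_of_le_dist (by
    rw [Real.dist_0_eq_abs]
    exact hx.le)
  have hdb0 : ∀ x : ℝ, 2 < |x| → deriv b x = 0 := fun x hx => by
    have : b =ᶠ[𝓝 x] fun _ => 0 := by
      filter_upwards [(isOpen_lt continuous_const continuous_abs).mem_nhds hx] with y hy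
      exact hb0 y hy
    rw [this.deriv_eq]
    simp
  have ha1 : ∀ x : ℝ, |x| < 3 → a x = 1 := fun x hx => a.one_of_mem_closedBall (by
    rw [mem_closedBall_zero_iff]
    exact hx.le)
  have hda0 : ∀ x : ℝ, |x| < 3 → deriv a x = 0 := fun x hx => by
    have : a =ᶠ[𝓝 x] fun _ => 1 := by
      filter_upwards [(isOpen_lt continuous_abs continuous_const).mem_nhds hx] with y hy
      exact ha1 y hy
    rw [this.deriv_eq]
    simp
  refine ⟨a, b, a.contDiff, b.contDiff, a.hasCompactSupport, b.hasCompactSupport, ?_, ?_, ?_, ?_,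
    ?_⟩
  · intro x
    rcases lt_or_ge 2 |x| with h | h
    · rw [hb0 x h, zero_mul]
    · rw [hda0 x (by linarith), mul_zero]
  · intro x
    rcases lt_or_ge 2 |x| with h | h
    · rw [hdb0 x h, zero_mul]
    · rw [hda0 x (by linarith), mul_zero]
  · intro x
    rcases lt_or_ge 2 |x| with h | h
    · rw [hdb0 x h, mul_zero]
    · rw [ha1 x (by linarith), one_mul]
  · intro x
    rw [abs_of_nonneg b.nonneg]
    exact b.le_one
  · by_contra! hc
    have h1 := is_const_of_deriv_eq_zero (b.contDiff.differentiable one_ne_zero) hc 0 3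
    rw [hb0 3 (by norm_num), b.one_of_mem_closedBall (by simp [b])] at h1
    exact one_ne_zero h1

variable {N : ℕ} {U : Set (Fin N → ℝ)} {η : Matrix (Fin N) (Fin N) ℝ} {K : ℝ}
  {H : Fin N → (Fin N → ℝ) → ℝ}

theorem isTest_smul {α : ℝ → ℝ} (hα : ContDiff ℝ ∞ α) (hc : HasCompactSupport α)
    (e : Fin N → ℝ) : IsTest fun x => α x • e :=
  ⟨hα.smul contDiff_const, hc.smul_right⟩

theorem deriv_smul_vec {α : ℝ → ℝ} (hα : ContDiff ℝ ∞ α) (e : Fin N → ℝ) (x : ℝ) :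
    deriv (fun x => α x • e) x = deriv α x • e :=
  ((hα.differentiable (by simp) x).hasDerivAt.smul_const e).deriv

/-- At a constant field the terms with `u_x` drop out. Covectors `αe`, `βb`, `βc` leave only the
defect with `e` undifferentiated, since the other two contain `β α'`; the integral is then the
defect times `∫ β'²`, which is positive. -/
theorem metricDefect_eq_zero_of_jacobi (hU : IsOpen U) (hη : η.IsSymm)
    (hH : ∀ i, ContDiffOn ℝ ∞ (H i) U)
    (hJ : ∀ u ξ ζ χ : ℝ → Fin N → ℝ, IsField U u → IsTest ξ → IsTest ζ → IsTest χ →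
        ∫ x, jacobiDensity η K H u ξ ζ χ x = 0) {v : Fin N → ℝ} (hv : v ∈ U)
    (e b c : Fin N → ℝ) : metricDefect η K H v e b c = 0 := by
  obtain ⟨α, β, hα, hβ, hαc, hβc, h1, -, h3, -, x₀, hx₀⟩ := exists_bump_cutoff
  have hu : IsField U fun _ => v := ⟨contDiff_const, fun _ => hv, by
    rw [deriv_const']
    exact HasCompactSupport.zero⟩
  have h := hJ _ _ _ _ hu (isTest_smul hα hαc e) (isTest_smul hβ hβc b) (isTest_smul hβ hβc c)
  have hd : ∀ x, jacobiDensity η K H (fun _ => v) (fun x => α x • e) (fun x => β x • b)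
      (fun x => β x • c) x = deriv β x ^ 2 * metricDefect η K H v e b c := by
    intro x
    rw [jacobiDensity_eq hU hη hH hu, deriv_smul_vec hα, deriv_smul_vec hβ, deriv_smul_vec hβ,
      metricDefect_smul, metricDefect_smul, metricDefect_smul]
    have z : ∀ ξ ζ b, hessDefect η H v ξ ζ (deriv (fun _ : ℝ => v) x) b = 0 := fun ξ ζ b => by
      simp [hessDefect]
    rw [z, z, z]
    linear_combination (metricDefect η K H v e b c * deriv β x) * h3 x
      + (metricDefect η K H v b c e * deriv β x + metricDefect η K H v c e b * deriv β x) * h1 x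
  simp_rw [hd] at h
  rw [integral_mul_const] at h
  have hβ' : Continuous (deriv β) := hβ.continuous_deriv (by simp)
  have hpos : 0 < ∫ x, deriv β x ^ 2 := by
    refine Continuous.integral_pos_of_hasCompactSupport_nonneg_nonzero (x := x₀) (by fun_prop) ?_
      (fun x => sq_nonneg _) (pow_ne_zero 2 hx₀)
    exact hβc.deriv.comp_left (g := fun y : ℝ => y ^ 2) (by simp)
  exact (mul_eq_zero.1 h).resolve_left hpos.ne'

/-- The field `v + δβw` has `u_x = δβ'w`. Giving the third covector the same profile `β` makes the
surviving term carry `β'²`, so contributions of different sign cannot come from the bump. The metric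
defects are already known to vanish at all points of `U`. -/
theorem hessDefect_eq_zero_of_jacobi (hU : IsOpen U) (hη : η.IsSymm)
    (hH : ∀ i, ContDiffOn ℝ ∞ (H i) U)
    (hJ : ∀ u ξ ζ χ : ℝ → Fin N → ℝ, IsField U u → IsTest ξ → IsTest ζ → IsTest χ →
        ∫ x, jacobiDensity η K H u ξ ζ χ x = 0) {v : Fin N → ℝ} (hv : v ∈ U)
    (e f w b : Fin N → ℝ) : hessDefect η H v e f w b = 0 := by
  obtain ⟨α, β, hα, hβ, hαc, hβc, h1, h2, h3, h4, x₀, hx₀⟩ := exists_bump_cutoff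
  by_contra hne
  -- Multiplying by the value at `v` makes the sign positive there, and hence nearby by continuity.
  set D : (Fin N → ℝ) → ℝ := fun y => hessDefect η H v e f w b * hessDefect η H y e f w b with hD
  have hDcont : ContinuousOn D U := by
    have hE : ∀ (ξ : Fin N → ℝ) (i j), ContDiffOn ℝ ∞ (fun y => hessSum H y ξ i j) U := by
      intro ξ i j
      simp only [hessSum_apply]
      exact ContDiffOn.sum fun k _ => contDiffOn_const.mul
        (contDiffOn_pd hU (contDiffOn_pd hU (hH k) j) i)
    have hterm : ∀ ξ ζ : Fin N → ℝ, ContDiffOn ℝ ∞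
        (fun y => b ⬝ᵥ (η *ᵥ (hessSum H y ξ *ᵥ (η *ᵥ (hessSum H y ζ *ᵥ w))))) U := fun ξ ζ =>
      contDiffOn_dotProduct contDiffOn_const (contDiffOn_const_mulVec η
        (contDiffOn_mulVec (hE ξ) (contDiffOn_const_mulVec η
          (contDiffOn_mulVec (hE ζ) contDiffOn_const))))
    exact (contDiffOn_const.mul ((hterm e f).sub (hterm f e))).continuousOn
  have hDv : 0 < D v := mul_self_pos.2 hne
  have hnhds : {y | y ∈ U ∧ 0 < D y} ∈ 𝓝 v := by
    filter_upwards [hU.mem_nhds hv,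
      (hDcont.continuousAt (hU.mem_nhds hv)).eventually (lt_mem_nhds hDv)] with y h h'
    exact ⟨h, h'⟩
  have hcurve : Tendsto (fun s : ℝ => v + s • w) (𝓝 0) (𝓝 v) := by
    have : Continuous fun s : ℝ => v + s • w := by fun_prop
    simpa using this.tendsto 0
  obtain ⟨ε, hε, hball⟩ := Metric.mem_nhds_iff.1 (hcurve hnhds)
  -- As `|β| ≤ 1`, half the radius keeps the whole excursion where `D` is positive.
  set δ := ε / 2 with hδ
  have hδ0 : 0 < δ := by positivity
  have hin : ∀ x, v + (δ * β x) • w ∈ U ∧ 0 < D (v + (δ * β x) • w) := by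
    intro x
    refine hball ?_
    rw [mem_ball_zero_iff, Real.norm_eq_abs, abs_mul, abs_of_pos hδ0]
    nlinarith [h4 x]
  have hdu : ∀ x, deriv (fun x => v + (δ * β x) • w) x = (δ * deriv β x) • w := fun x =>
    ((((hβ.differentiable (by simp) x).hasDerivAt.const_mul δ).smul_const w).const_add v).deriv
  have hu : IsField U fun x => v + (δ * β x) • w := by
    refine ⟨by fun_prop, fun x => (hin x).1, ?_⟩
    have : deriv (fun x => v + (δ * β x) • w) = fun x => (δ * deriv β x) • w := funext hdu
    rw [this]
    exact (hβc.deriv.mul_left (f := fun _ => δ)).smul_right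
  -- The surviving cyclic term takes the second covector before the first, so `f` is placed first
  -- and `e` second; the other two terms contain `α' β'`.
  have h := hJ _ _ _ _ hu (isTest_smul hα hαc f) (isTest_smul hα hαc e) (isTest_smul hβ hβc b)
  have hd : ∀ x, jacobiDensity η K H (fun x => v + (δ * β x) • w) (fun x => α x • f)
      (fun x => α x • e) (fun x => β x • b) x =
        δ * deriv β x ^ 2 * hessDefect η H (v + (δ * β x) • w) e f w b := by
    intro x
    have hm := fun e b c => metricDefect_eq_zero_of_jacobi hU hη hH hJ (hin x).1 e b c
    rw [jacobiDensity_eq hU hη hH hu, hm, hm, hm, hdu, deriv_smul_vec hα, deriv_smul_vec hα,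
      deriv_smul_vec hβ, hessDefect_smul, hessDefect_smul, hessDefect_smul]
    set y := v + (δ * β x) • w
    linear_combination
      (hessDefect η H y f b w e * α x * β x * δ + hessDefect η H y b e w f * α x * β x * δ) * h2 x
      + (hessDefect η H y e f w b * δ * (α x * deriv β x + deriv β x)) * h3 x
  simp_rw [hd] at h
  have hpos : 0 < ∫ x, hessDefect η H v e f w b *
      (δ * deriv β x ^ 2 * hessDefect η H (v + (δ * β x) • w) e f w b) := by
    have hrew : ∀ x, hessDefect η H v e f w b *
        (δ * deriv β x ^ 2 * hessDefect η H (v + (δ * β x) • w) e f w b) =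
          deriv β x ^ 2 * (δ * D (v + (δ * β x) • w)) := fun x => by
      rw [hD]
      ring
    simp_rw [hrew]
    have hβ' : Continuous (deriv β) := hβ.continuous_deriv (by simp)
    have hDc : Continuous fun x => D (v + (δ * β x) • w) :=
      hDcont.comp_continuous hu.1.continuous fun x => (hin x).1
    have hpos' : ∀ x, 0 < δ * D (v + (δ * β x) • w) := fun x => mul_pos hδ0 (hin x).2
    refine Continuous.integral_pos_of_hasCompactSupport_nonneg_nonzero (x := x₀)
      ((hβ'.pow 2).mul (continuous_const.mul hDc)) ?_
      (fun x => mul_nonneg (sq_nonneg _) (hpos' x).le)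
      (mul_ne_zero (pow_ne_zero 2 hx₀) (hpos' x₀).ne')
    exact (hβc.deriv.comp_left (g := fun y : ℝ => y ^ 2) (by simp)).mul_right
  rw [integral_const_mul, h, mul_zero] at hpos
  exact lt_irrefl _ hpos

end Necessity

/-! ### The criterion in matrix and index form -/

section Criterion

variable {N : ℕ} {U : Set (Fin N → ℝ)} {η : Matrix (Fin N) (Fin N) ℝ} {K : ℝ}
  {H : Fin N → (Fin N → ℝ) → ℝ}

/-- Both defects are linear in their covector arguments, so their vanishing can be tested on basis
vectors, where the contracted Hessians become the individual `hess (H k) v`. -/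
theorem isPoissonBracket_iff_hess (hU : IsOpen U) (hη : η.IsSymm) (hdet : η.det ≠ 0)
    (hH : ∀ i, ContDiffOn ℝ ∞ (H i) U) :
    IsPoissonBracket U (canonicalMetric η K H) (canonicalConnection η K H) K ↔
      (∀ v ∈ U, ∀ i j, hess (H i) v * η * hess (H j) v = hess (H j) v * η * hess (H i) v) ∧
      (∀ v ∈ U, ∀ k, (η * hess (H k) v * Matrix.of (canonicalMetric η K H v))ᵀ =
        η * hess (H k) v * Matrix.of (canonicalMetric η K H v)) := by
  rw [isPoissonBracket_iff_integral_jacobiDensity hU hη hH]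
  constructor
  · intro hJ
    constructor
    · intro v hv i j
      have h : ∀ w b, b ⬝ᵥ ((η * (hess (H i) v * η * hess (H j) v)) *ᵥ w) =
          b ⬝ᵥ ((η * (hess (H j) v * η * hess (H i) v)) *ᵥ w) := by
        intro w b
        have h1 := hessDefect_eq_zero_of_jacobi hU hη hH hJ hv ((1 : ℝ) • Pi.single i 1)
          ((1 : ℝ) • Pi.single j 1) w b
        rw [hessDefect, hessSum_smul_single, hessSum_smul_single, one_smul, one_smul,
          sub_eq_zero] at h1
        simpa only [mulVec_mulVec, Matrix.mul_assoc] using h1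
      have h2 : η * (hess (H i) v * η * hess (H j) v) = η * (hess (H j) v * η * hess (H i) v) := by
        ext k l
        have := h (Pi.single l 1) (Pi.single k 1)
        simpa using this
      -- The Jacobi identity yields the commutation only after left multiplication by `η`;
      -- nondegeneracy of `η` is needed just to strip this factor.
      have hunit : IsUnit η.det := isUnit_iff_ne_zero.2 hdet
      have h3 := congrArg (fun A => η⁻¹ * A) h2
      simpa only [nonsing_inv_mul_cancel_left _ _ hunit] using h3
    · intro v hv k
      ext i j
      have h1 := metricDefect_eq_zero_of_jacobi hU hη hH hJ hv ((1 : ℝ) • Pi.single k 1)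
        (Pi.single j 1) (Pi.single i 1)
      rw [metricDefect, hessSum_smul_single, one_smul, sub_eq_zero, mulVec_mulVec, mulVec_mulVec,
        mulVec_mulVec, mulVec_mulVec] at h1
      simpa only [single_one_dotProduct, mulVec_single_one, transpose_apply, col_apply] using h1
  · rintro ⟨h1, h2⟩ u ξ ζ χ hu - - -
    have : ∀ x, jacobiDensity η K H u ξ ζ χ x = 0 := fun x => by
      rw [jacobiDensity_eq hU hη hH hu]
      simp only [metricDefect_eq_zero (h2 _ (hu.2.1 x)), hessDefect_eq_zero (h1 _ (hu.2.1 x)),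
        add_zero]
    simp [this]

theorem hess_mul_mul_apply (v : Fin N → ℝ) (i j k l : Fin N) :
    (hess (H i) v * η * hess (H j) v) k l =
      ∑ s, ∑ p, pd k (pd s (H i)) v * η s p * pd p (pd l (H j)) v := by
  simp only [mul_apply, hess, of_apply, Finset.sum_mul]
  exact Finset.sum_comm

/-- Symmetry of the metric lets its free index `i` come first, matching the index form of the second
system; exchanging `i` and `j` there is then transposition of this matrix. -/
theorem mul_hess_mul_apply (v : Fin N → ℝ) (i j k : Fin N) :
    (η * hess (H k) v * Matrix.of (canonicalMetric η K H v)) j i =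
      ∑ s, ∑ p, canonicalMetric η K H v i s * η j p * pd p (pd s (H k)) v := by
  rw [← transpose_canonicalMetric]
  simp only [mul_apply, hess, of_apply, Finset.sum_mul, transpose_apply]
  exact Finset.sum_congr rfl fun s _ => Finset.sum_congr rfl fun p _ => by ring

end Criterion

end

end Hydro

theorem theorem2 (N : ℕ) (η : Matrix (Fin N) (Fin N) ℝ) (hη : η.IsSymm) (hdet : η.det ≠ 0)
    (K₁ : ℝ) (U : Set (Fin N → ℝ)) (hU : IsOpen U)
    (H : Fin N → (Fin N → ℝ) → ℝ) (hH : ∀ i, ContDiffOn ℝ ∞ (H i) U) :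
    Hydro.IsPoissonBracket U (Hydro.canonicalMetric η K₁ H)
        (Hydro.canonicalConnection η K₁ H) K₁ ↔
      (∀ u ∈ U, ∀ i j k l : Fin N,
        ∑ s, ∑ p, Hydro.pd k (Hydro.pd s (H i)) u * η s p * Hydro.pd p (Hydro.pd l (H j)) u =
          ∑ s, ∑ p, Hydro.pd k (Hydro.pd s (H j)) u * η s p * Hydro.pd p (Hydro.pd l (H i)) u) ∧
      (∀ u ∈ U, ∀ i j k : Fin N,
        ∑ s, ∑ p, ((∑ r, η i r * Hydro.pd r (H s) u) + (∑ r, η s r * Hydro.pd r (H i) u)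
            - K₁ * u i * u s) * η j p * Hydro.pd p (Hydro.pd s (H k)) u =
          ∑ s, ∑ p, ((∑ r, η j r * Hydro.pd r (H s) u) + (∑ r, η s r * Hydro.pd r (H j) u)
            - K₁ * u j * u s) * η i p * Hydro.pd p (Hydro.pd s (H k)) u) := by
  rw [Hydro.isPoissonBracket_iff_hess hU hη hdet hH]
  refine and_congr (forall₂_congr fun v _ => forall₂_congr fun i j => ?_)
    (forall₂_congr fun v _ => ⟨fun h i j k => ?_, fun h k => ?_⟩)
  · rw [← Matrix.ext_iff]
    simp only [Hydro.hess_mul_mul_apply]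
  · have := congrFun (congrFun (h k) i) j
    rw [Matrix.transpose_apply, Hydro.mul_hess_mul_apply, Hydro.mul_hess_mul_apply] at this
    exact this
  · ext i j
    rw [Matrix.transpose_apply, Hydro.mul_hess_mul_apply, Hydro.mul_hess_mul_apply]
    exact h i j k
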